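/- Let $G$ be a compact connected metric graph: a finite set of edges $e$, each identified with an interval $[0,|e|]$ with $|e|>0$, whose ends are glued according to a partition of the set of all ends into vertices. For a bounded measurable $q:G\to\mathbb R$ let $\lambda_1(q)<\lambda_2(q)\le\dots$ denote the eigenvalues, counted with multiplicity, of the Schrödinger operator $Hu=-u''+qu$ on $G$ with standard (Kirchhoff) conditions, i.e. acting on functions $u$ that are continuous on $G$, of class $W^{2,2}$ on each edge, and such that at every vertex the derivatives of $u$ along the incident edge ends, directed into the vertex, sum to $0$. Let $\Gamma[q]=\lambda_2(q)-\lambda_1(q)$. A path in $G$ is given by a continuous map $\gamma:[0,1]\to G$ that is injective except that $\gamma(0)=\gamma(1)$ is allowed; $q$ is convex on it if it is convex along $\gamma$ as a function of arc length (a closed path being regarded as an interval cut at $\gamma(0)=\gamma(1)$). Fix a finite family $\mathcal P$ of paths in $G$, a subtree $T\subset G$ (a connected subgraph, possibly of a subdivision of $G$, that contains no cycle), and $M>0$. Let - $C_{G,\mathcal P,M}$ be the set of measurable $q:G\to\mathbb R$ with $0\le q\le M$ on $G$ that are convex on every path in $\mathcal P$; - $SW_{G,T,M}$ be the set of measurable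 $q:G\to\mathbb R$ with $0\le q\le M$ on $G$ that are single-well on $T$, i.e. for which there is a point $a\in T$ such that $q$ is nonincreasing along every path in $T$ from a leaf (a point of degree $1$ in $T$) to $a$. Let $\Lambda$ be either $C_{G,\mathcal P,M}$ or $SW_{G,T,M}$. Then for every $q\in\Lambda$ the eigenvalues $\lambda_1(q)$ and $\lambda_2(q)$ exist, and there are $q_*,q^*\in\Lambda$ with $$\Gamma[q_*]=\min\{\Gamma[q]:q\in\Lambda\},\qquad \Gamma[q^*]=\max\{\Gamma[q]:q\in\Lambda\}.$$ -/

import Mathlib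

open Set Filter Topology MeasureTheory

noncomputable section

/-- A metric graph with edge set `E`: every edge `e` is identified with `[0, len e]`, its two ends
are `(e, false)` (the point `0`) and `(e, true)` (the point `len e`), and the ends of all edges are
partitioned into equivalence classes, the vertices. Loops and multiple edges are allowed. -/
structure MetricGraph (E : Type*) where
  len : E → ℝ
  len_pos : ∀ e, 0 < len e
  vertexSetoid : Setoid (E × Bool)

namespace MetricGraph

variable {E : Type*} (G : MetricGraph E)

/-- The vertices: equivalence classes of ends of edges. -/
abbrev Vertex : Type _ := Quotient G.vertexSetoid

/-- The disjoint union of the edges. -/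
abbrev PrePoint : Type _ := Σ e : E, Icc (0 : ℝ) (G.len e)

/-- The point of the disjoint union of the edges at an end of an edge. -/
def endPoint (a : E × Bool) : G.PrePoint :=
  ⟨a.1, if a.2 then ⟨G.len a.1, right_mem_Icc.2 (G.len_pos a.1).le⟩
    else ⟨0, left_mem_Icc.2 (G.len_pos a.1).le⟩⟩

theorem endPoint_injective : Function.Injective G.endPoint := by
  rintro ⟨e, b⟩ ⟨e', b'⟩ h
  have he : e = e' := congrArg Sigma.fst h
  subst he
  have h2 := eq_of_heq (Sigma.mk.inj h).2
  have hp := G.len_pos e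
  cases b <;> cases b' <;> simp [Subtype.ext_iff] at h2 ⊢ <;> linarith

/-- Two ends of edges are glued together when they belong to the same vertex. -/
def glue : Setoid G.PrePoint where
  r x y := x = y ∨ ∃ a b, G.vertexSetoid a b ∧ x = G.endPoint a ∧ y = G.endPoint b
  iseqv :=
    { refl := fun _ => Or.inl rfl
      symm := by
        rintro x y (rfl | ⟨a, b, h, rfl, rfl⟩)
        · exact Or.inl rfl
        · exact Or.inr ⟨b, a, G.vertexSetoid.symm h, rfl, rfl⟩
      trans := by
        rintro x y z (rfl | ⟨a, b, h, rfl, rfl⟩) (rfl | ⟨c, d, h', hc, rfl⟩)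
        · exact Or.inl rfl
        · exact Or.inr ⟨c, d, h', hc, rfl⟩
        · exact Or.inr ⟨a, b, h, rfl, rfl⟩
        · obtain rfl := G.endPoint_injective hc
          exact Or.inr ⟨a, d, G.vertexSetoid.trans h h', rfl, rfl⟩ }

/-- The points of the metric graph, with the quotient topology. -/
def Point : Type _ := Quotient G.glue

instance : TopologicalSpace G.Point := inferInstanceAs (TopologicalSpace (Quotient G.glue))

/-- The point of the graph at the coordinate `t ∈ [0, len e]` of the edge `e`
(coordinates outside this interval are projected to it). -/
def pt (e : E) (t : ℝ) : G.Point :=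
  Quotient.mk G.glue ⟨e, projIcc 0 (G.len e) (G.len_pos e).le t⟩

/-- Lebesgue measure on the edge `e`. -/
def edgeMeasure (e : E) : Measure ℝ := volume.restrict (Icc 0 (G.len e))

/-- The length (one-dimensional measure) of a subset of the graph. -/
def setLength [Fintype E] (S : Set G.Point) : ℝ :=
  ∑ e, (volume {t | t ∈ Icc 0 (G.len e) ∧ G.pt e t ∈ S}).toReal

/-! ### The Schrödinger operator with Kirchhoff conditions -/

/-- `u` is continuous on the graph and of class `W^{2,2}` on each edge, with (edgewise) first and
second derivatives `u'` and `u''`: `u` is continuously differentiable on each closed edge and its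
derivative is absolutely continuous with derivative `u'' ∈ L²`. -/
structure IsH2 (u : G.Point → ℝ) (u' u'' : E → ℝ → ℝ) : Prop where
  continuous : Continuous u
  hasDeriv : ∀ e, ∀ t ∈ Icc 0 (G.len e),
    HasDerivWithinAt (fun s => u (G.pt e s)) (u' e t) (Icc 0 (G.len e)) t
  memLp : ∀ e, MemLp (u'' e) 2 (G.edgeMeasure e)
  deriv_eq : ∀ e, ∀ t ∈ Icc 0 (G.len e), u' e t = u' e 0 + ∫ s in (0 : ℝ)..t, u'' e s

/-- The derivative at an end of an edge, in the direction pointing into the vertex. -/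
def normalDeriv (u' : E → ℝ → ℝ) (a : E × Bool) : ℝ :=
  if a.2 then u' a.1 (G.len a.1) else - u' a.1 0

open Classical in
/-- The Kirchhoff condition at every vertex. -/
def Kirchhoff [Fintype E] (u' : E → ℝ → ℝ) : Prop :=
  ∀ v : G.Vertex, ∑ a : E × Bool with (Quotient.mk G.vertexSetoid a) = v, G.normalDeriv u' a = 0

/-- `u` is an eigenfunction, with eigenvalue `μ`, of the Schrödinger operator `-u'' + q u` with
Kirchhoff conditions at all vertices. -/
def IsEigenfunction [Fintype E] (q : G.Point → ℝ) (μ : ℝ) (u : G.Point → ℝ) : Prop :=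
  u ≠ 0 ∧ ∃ u' u'' : E → ℝ → ℝ, G.IsH2 u u' u'' ∧ G.Kirchhoff u' ∧
    ∀ e, ∀ᵐ t ∂(G.edgeMeasure e),
      - u'' e t + q (G.pt e t) * u (G.pt e t) = μ * u (G.pt e t)

/-- The numbers `x` such that there are at least `n` eigenvalues `≤ x`, counted with
multiplicity. -/
def atLeastEigenvalues [Fintype E] (q : G.Point → ℝ) (n : ℕ) : Set ℝ :=
  {x | ∃ u : Fin n → G.Point → ℝ, LinearIndependent ℝ u ∧
    ∀ i, ∃ μ ≤ x, G.IsEigenfunction q μ (u i)}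

/-- The `n`-th eigenvalue `λₙ(q)` (`n ≥ 1`), in increasing order and counted with multiplicity. -/
def eigenvalue [Fintype E] (q : G.Point → ℝ) (n : ℕ) : ℝ := sInf (G.atLeastEigenvalues q n)

/-- The fundamental gap `Γ[q] = λ₂(q) - λ₁(q)`. -/
def gap [Fintype E] (q : G.Point → ℝ) : ℝ := G.eigenvalue q 2 - G.eigenvalue q 1

/-! ### Paths and trees -/

/-- A path: a continuous map from `[0,1]` to the graph, injective except that the two end points
may coincide. -/
structure GPath where
  map : C(unitInterval, G.Point)
  inj : ∀ s t, s < t → map s = map t → s = 0 ∧ t = 1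

/-- A subgraph (of some subdivision): a finite union of nondegenerate closed edge segments. -/
def IsSubgraph (T : Set G.Point) : Prop :=
  ∃ S : Finset (E × ℝ × ℝ), (∀ p ∈ S, 0 ≤ p.2.1 ∧ p.2.1 < p.2.2 ∧ p.2.2 ≤ G.len p.1) ∧
    T = ⋃ p ∈ S, G.pt p.1 '' Icc p.2.1 p.2.2

/-- A tree in the graph: a connected subgraph without cycles. -/
structure IsTree (T : Set G.Point) : Prop where
  subgraph : G.IsSubgraph T
  connected : IsConnected T
  acyclic : ∀ γ : G.GPath, range γ.map ⊆ T → γ.map 0 ≠ γ.map 1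

/-- The degree of the point `x` in the subgraph `T`: the number of edge directions `(e, t, σ)`,
with `σ = ±1`, that start at `x`, the point of coordinate `t` on `e`, and stay in `T` initially. -/
def degree (T : Set G.Point) (x : G.Point) : ℕ :=
  Set.ncard {g : E × ℝ × ℝ | g.2.1 ∈ Icc 0 (G.len g.1) ∧ (g.2.2 = 1 ∨ g.2.2 = -1) ∧
    G.pt g.1 g.2.1 = x ∧
    ∀ᶠ s in 𝓝[>] (0 : ℝ), g.2.1 + g.2.2 * s ∈ Icc 0 (G.len g.1) ∧
      G.pt g.1 (g.2.1 + g.2.2 * s) ∈ T}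

/-- The boundary of a tree: its leaves. -/
def leaves (T : Set G.Point) : Set G.Point := {x | x ∈ T ∧ G.degree T x = 1}

/-! ### The two classes of potentials -/

/-- The measurable potentials with `0 ≤ q ≤ M` on the graph. -/
def boundedClass (M : ℝ) : Set (G.Point → ℝ) :=
  {q | (∀ e, AEStronglyMeasurable (fun t => q (G.pt e t)) (G.edgeMeasure e)) ∧
    ∀ x, 0 ≤ q x ∧ q x ≤ M}

/-- `q` is convex along the path `γ`, regarded as an interval: convex as a function of the arc
length. A closed path is cut at `γ 0 = γ 1`. -/
def ConvexAlong [Fintype E] (q : G.Point → ℝ) (γ : G.GPath) : Prop :=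
  ∀ r s t : unitInterval, r ≤ s → s ≤ t →
    G.setLength (γ.map '' Icc r t) * q (γ.map s) ≤
      G.setLength (γ.map '' Icc s t) * q (γ.map r) + G.setLength (γ.map '' Icc r s) * q (γ.map t)

/-- The convex class `C_{G,P,M}`. -/
def convexClass [Fintype E] (P : Set G.GPath) (M : ℝ) : Set (G.Point → ℝ) :=
  {q | q ∈ G.boundedClass M ∧ ∀ γ ∈ P, G.ConvexAlong q γ}

/-- `q` is single-well on the tree `T`: for some `a ∈ T` it is nonincreasing along every path in
`T` from a leaf of `T` to `a`. -/
def SingleWellOn (T : Set G.Point) (q : G.Point → ℝ) : Prop :=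
  ∃ a ∈ T, ∀ γ : G.GPath, range γ.map ⊆ T → γ.map 0 ∈ G.leaves T → γ.map 1 = a →
    Antitone fun s => q (γ.map s)

/-- The single-well class `SW_{G,T,M}`. -/
def singleWellClass (T : Set G.Point) (M : ℝ) : Set (G.Point → ℝ) :=
  {q | q ∈ G.boundedClass M ∧ G.SingleWellOn T q}

end MetricGraph

end

/-! The eigenvalues are critical values of the Rayleigh quotient on the Sobolev space `H¹`. The unit
ball of `H¹` is relatively compact in the space of continuous functions, so weak convergence of
uniformly bounded potentials makes the quadratic forms converge uniformly on this ball, and by the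
min-max principle the eigenvalues converge. Hence the gap is continuous for weak convergence, and it
remains to see that both classes are weakly sequentially compact.

A bounded sequence of potentials that are eventually monotone or convex on a segment has, by Helly's
theorem and by the equicontinuity of bounded convex functions, a subsequence that converges on this
segment off a countable set. The weak limit therefore agrees almost everywhere with a pointwise
limit along an ultrafilter, and the latter inherits the inequalities defining the class. For
single-well potentials a subsequence of the bottoms converges, along a single edge segment of the
tree, and every path from a leaf to the limiting bottom is eventually monotone away from its end. -/

/-! ### Variational eigenvalues -/

section EllipticPair

variable {V : Type*} [NormedAddCommGroup V] [NormedSpace ℝ V] {a b a' : V →L[ℝ] V →L[ℝ] ℝ}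

/-- The setting of the variational eigenvalue problem `a u = μ b u`: the form `a` satisfies a
Gårding inequality relative to the inner product `b`, and the embedding of `V` into the completion
for `b` is compact. Compactness is expressed through `b`-Cauchy subsequences, so that the completion
does not appear. -/
structure IsEllipticPair (a b : V →L[ℝ] V →L[ℝ] ℝ) : Prop where
  symm_left : ∀ u v, a u v = a v u
  symm_right : ∀ u v, b u v = b v u
  pos : ∀ v ≠ 0, 0 < b v v
  coercive : ∃ c > 0, ∃ C, ∀ v, c * ‖v‖ ^ 2 ≤ a v v + C * b v v
  compact : ∀ (x : ℕ → V) (R : ℝ), (∀ n, ‖x n‖ ≤ R) → ∃ φ : ℕ → ℕ, StrictMono φ ∧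
    Tendsto (fun p : ℕ × ℕ => b (x (φ p.1) - x (φ p.2)) (x (φ p.1) - x (φ p.2))) atTop (𝓝 0)

/-- The vector `u` minimises the Rayleigh quotient `a v v / b v v` among the vectors that are
`b`-orthogonal to `S`, and is normalised. -/
structure IsRayleighMinimizer (a b : V →L[ℝ] V →L[ℝ] ℝ) (S : Set V) (u : V) : Prop where
  orthogonal : ∀ w ∈ S, b w u = 0
  normalized : b u u = 1
  le : ∀ v, (∀ w ∈ S, b w v = 0) → a u u * b v v ≤ a v v

/-- Each `w n` minimises the Rayleigh quotient on the `b`-orthogonal complement of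
`w 0, …, w (n - 1)`; the numbers `a (w n) (w n)` are then the eigenvalues in increasing order. -/
def IsRayleighSequence (a b : V →L[ℝ] V →L[ℝ] ℝ) (w : ℕ → V) : Prop :=
  ∀ n, IsRayleighMinimizer a b (w '' Iio n) (w n)

theorem parallelogram_identity (c : V →L[ℝ] V →L[ℝ] ℝ) (u v : V) :
    c (u - v) (u - v) = 2 * c u u + 2 * c v v - c (u + v) (u + v) := by
  simp only [map_sub, map_add, sub_apply, add_apply]
  ring

theorem exists_seq_of_forall_finite_exists {α : Type*} {r : Set α → α → Prop}
    (h : ∀ S : Set α, S.Finite → ∃ x, r S x) : ∃ w : ℕ → α, ∀ n, r (w '' Iio n) (w n) := by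
  have : Nonempty α := (h ∅ finite_empty).nonempty
  choose! next hnext using h
  let w : ℕ → α := fun n => Nat.strongRec (fun n ih => next (range fun i : Iio n => ih i i.2)) n
  have hw : ∀ n, w n = next (w '' Iio n) := fun n => by
    rw [image_eq_range]
    exact Nat.strongRec_eq _ n
  exact ⟨w, fun n => by
    conv in w n => rw [hw n]
    exact hnext _ ((finite_Iio n).image w)⟩

theorem exists_ne_zero_forall_apply_eq_zero (hV : ¬ Module.Finite ℝ V)
    (b : V →L[ℝ] V →L[ℝ] ℝ) {S : Set V} (hS : S.Finite) : ∃ v ≠ 0, ∀ w ∈ S, b w v = 0 := by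
  have := hS.to_subtype
  by_contra! hinj
  let f : V →ₗ[ℝ] (S → ℝ) := LinearMap.pi fun w => (b w).toLinearMap
  refine hV (Module.Finite.of_injective f ((injective_iff_map_eq_zero f).2 fun v hv => ?_))
  by_contra hv0
  obtain ⟨w, hwS, hw⟩ := hinj v hv0
  exact hw (congrFun hv ⟨w, hwS⟩)

namespace IsEllipticPair

theorem apply_self_nonneg (h : IsEllipticPair a b) (v : V) : 0 ≤ b v v := by
  rcases eq_or_ne v 0 with rfl | hv
  · simp
  · exact (h.pos v hv).le

theorem exists_smul_apply_self_eq_one (h : IsEllipticPair a b) {v : V} (hv : v ≠ 0) :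
    ∃ c : ℝ, b (c • v) (c • v) = 1 ∧ a (c • v) (c • v) * b v v = a v v := by
  have hpos := h.pos v hv
  have hsq : √(b v v) ^ 2 = b v v := Real.sq_sqrt hpos.le
  have hne : √(b v v) ≠ 0 := (Real.sqrt_pos.2 hpos).ne'
  refine ⟨(√(b v v))⁻¹, ?_, ?_⟩ <;> simp only [map_smul, smul_apply, smul_eq_mul] <;>
    field_simp <;> rw [hsq]
  exact mul_comm _ _

theorem exists_minimizing_sequence (h : IsEllipticPair a b) {S : Set V}
    (hS : ∃ v ≠ 0, ∀ w ∈ S, b w v = 0) :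
    ∃ (l : ℝ) (x : ℕ → V), (∀ v, (∀ w ∈ S, b w v = 0) → l * b v v ≤ a v v) ∧
      (∀ n, ∀ w ∈ S, b w (x n) = 0) ∧ (∀ n, b (x n) (x n) = 1) ∧
      Tendsto (fun n => a (x n) (x n)) atTop (𝓝 l) := by
  let values : Set ℝ := (fun v => a v v) '' {v | (∀ w ∈ S, b w v = 0) ∧ b v v = 1}
  have hmem : ∀ v ≠ 0, (∀ w ∈ S, b w v = 0) → ∃ r ∈ values, r * b v v = a v v := by
    intro v hv hvS
    obtain ⟨c, hc, hca⟩ := h.exists_smul_apply_self_eq_one hv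
    exact ⟨_, ⟨c • v, ⟨fun w hw => by rw [map_smul, hvS w hw, smul_zero], hc⟩, rfl⟩, hca⟩
  have hne : values.Nonempty := by
    obtain ⟨v, hv, hvS⟩ := hS
    obtain ⟨r, hr, -⟩ := hmem v hv hvS
    exact ⟨r, hr⟩
  have hbdd : BddBelow values := by
    obtain ⟨c, hc, C, hcoer⟩ := h.coercive
    refine ⟨-C, ?_⟩
    rintro _ ⟨v, ⟨-, hv⟩, rfl⟩
    have hv' := hcoer v
    rw [hv] at hv'
    dsimp only
    linarith [mul_nonneg hc.le (sq_nonneg ‖v‖)]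
  obtain ⟨r, -, hr, hrmem⟩ := exists_seq_tendsto_sInf hne hbdd
  choose x hx hxr using hrmem
  refine ⟨sInf values, x, fun v hv => ?_, fun n => (hx n).1, fun n => (hx n).2,
    hr.congr fun n => (hxr n).symm⟩
  rcases eq_or_ne v 0 with rfl | hv0
  · simp
  · obtain ⟨r, hr, hra⟩ := hmem v hv0 hv
    rw [← hra]
    exact mul_le_mul_of_nonneg_right (csInf_le hbdd hr) (h.apply_self_nonneg v)

/-- The parallelogram law for both forms turns `b`-Cauchy minimising sequences into Cauchy
sequences: the midpoints cannot have a smaller Rayleigh quotient than the infimum. -/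
theorem cauchySeq_of_minimizing (h : IsEllipticPair a b) {S : Set V} {l : ℝ} {x : ℕ → V}
    (hl : ∀ v, (∀ w ∈ S, b w v = 0) → l * b v v ≤ a v v)
    (hxS : ∀ n, ∀ w ∈ S, b w (x n) = 0) (hx1 : ∀ n, b (x n) (x n) = 1)
    (hx : Tendsto (fun n => a (x n) (x n)) atTop (𝓝 l))
    (hcau : Tendsto (fun p : ℕ × ℕ => b (x p.1 - x p.2) (x p.1 - x p.2)) atTop (𝓝 0)) :
    CauchySeq x := by
  obtain ⟨c, hc, C, hcoer⟩ := h.coercive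
  have hfst : Tendsto (fun p : ℕ × ℕ => a (x p.1) (x p.1)) atTop (𝓝 l) := by
    rw [← prod_atTop_atTop_eq]
    exact hx.comp tendsto_fst
  have hsnd : Tendsto (fun p : ℕ × ℕ => a (x p.2) (x p.2)) atTop (𝓝 l) := by
    rw [← prod_atTop_atTop_eq]
    exact hx.comp tendsto_snd
  have hbound : Tendsto (fun p : ℕ × ℕ => √(c⁻¹ * (2 * a (x p.1) (x p.1) + 2 * a (x p.2) (x p.2)
      - l * (4 - b (x p.1 - x p.2) (x p.1 - x p.2))
      + C * b (x p.1 - x p.2) (x p.1 - x p.2)))) atTop (𝓝 0) := by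
    have := ((((hfst.const_mul 2).add (hsnd.const_mul 2)).sub
      ((hcau.const_sub 4).const_mul l)).add (hcau.const_mul C)).const_mul c⁻¹
    rw [show c⁻¹ * (2 * l + 2 * l - l * (4 - 0) + C * 0) = 0 by ring] at this
    simpa using this.sqrt
  rw [cauchySeq_iff_tendsto_dist_atTop_0]
  refine squeeze_zero (fun _ => dist_nonneg) (fun p => ?_) hbound
  rw [dist_eq_norm]
  refine Real.le_sqrt_of_sq_le ((le_inv_mul_iff₀ hc).2 ((hcoer _).trans ?_))
  have ha := parallelogram_identity a (x p.1) (x p.2)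
  have hb := parallelogram_identity b (x p.1) (x p.2)
  have hmid := hl (x p.1 + x p.2) fun w hw => by simp only [map_add, hxS _ w hw, add_zero]
  rw [hx1, hx1] at hb
  rw [show b (x p.1 + x p.2) (x p.1 + x p.2) = 4 - b (x p.1 - x p.2) (x p.1 - x p.2) by
    linarith] at hmid
  linarith

theorem exists_isRayleighMinimizer [CompleteSpace V] (h : IsEllipticPair a b) {S : Set V}
    (hS : ∃ v ≠ 0, ∀ w ∈ S, b w v = 0) : ∃ u, IsRayleighMinimizer a b S u := by
  obtain ⟨l, x, hl, hxS, hx1, hx⟩ := h.exists_minimizing_sequence hS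
  have hbdd : ∃ R, ∀ n, ‖x n‖ ≤ R := by
    obtain ⟨c, hc, C, hcoer⟩ := h.coercive
    obtain ⟨B, hB⟩ := hx.bddAbove_range
    refine ⟨√(c⁻¹ * (B + C)), fun n => Real.le_sqrt_of_sq_le ((le_inv_mul_iff₀ hc).2 ?_)⟩
    have := hcoer (x n)
    rw [hx1, mul_one] at this
    linarith [hB ⟨n, rfl⟩]
  obtain ⟨R, hR⟩ := hbdd
  obtain ⟨φ, hφ, hcau⟩ := h.compact x R hR
  have hxφ : Tendsto (fun n => a (x (φ n)) (x (φ n))) atTop (𝓝 l) := hx.comp hφ.tendsto_atTop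
  obtain ⟨u, hu⟩ := cauchySeq_tendsto_of_complete
    (h.cauchySeq_of_minimizing hl (fun n => hxS (φ n)) (fun n => hx1 (φ n)) hxφ hcau)
  have hlim : ∀ f : V → ℝ, Continuous f → ∀ y, Tendsto (fun n => f (x (φ n))) atTop (𝓝 y) →
      f u = y := fun f hf y hy => tendsto_nhds_unique ((hf.tendsto u).comp hu) hy
  have hau : a u u = l := hlim (fun v => a v v) (by fun_prop) l hxφ
  refine ⟨u, fun w hw => ?_, ?_, hau ▸ hl⟩
  · exact hlim (b w) (b w).continuous 0 (by simp only [hxS _ w hw, tendsto_const_nhds])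
  · exact hlim (fun v => b v v) (by fun_prop) 1 (by simp only [hx1, tendsto_const_nhds])

theorem exists_isRayleighSequence [CompleteSpace V] (h : IsEllipticPair a b)
    (hV : ¬ Module.Finite ℝ V) : ∃ w, IsRayleighSequence a b w :=
  exists_seq_of_forall_finite_exists fun _ hS =>
    h.exists_isRayleighMinimizer (exists_ne_zero_forall_apply_eq_zero hV b hS)

end IsEllipticPair

theorem IsRayleighMinimizer.apply_eq (h : IsEllipticPair a b) {S : Set V} {u : V}
    (hu : IsRayleighMinimizer a b S u) {v : V} (hv : ∀ w ∈ S, b w v = 0) :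
    a u v = a u u * b u v := by
  have hquad : ∀ t : ℝ, 0 ≤ (a v v - a u u * b v v) * (t * t)
      + 2 * (a u v - a u u * b u v) * t + 0 := by
    intro t
    have := hu.le (u + t • v) fun w hw => by
      simp only [map_add, map_smul, hu.orthogonal w hw, hv w hw, smul_zero, add_zero]
    simp only [map_add, map_smul, add_apply, smul_apply, smul_eq_mul, hu.normalized,
      h.symm_left v u, h.symm_right v u] at this
    linarith
  have hdiscrim := discrim_le_zero hquad
  rw [discrim, mul_zero, sub_zero, mul_pow] at hdiscrim
  nlinarith

namespace IsRayleighSequence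

variable {w w' : ℕ → V}

theorem apply_eq_ite (h : IsEllipticPair a b) (hw : IsRayleighSequence a b w) (i j : ℕ) :
    b (w i) (w j) = if i = j then 1 else 0 := by
  rcases lt_trichotomy i j with hij | rfl | hij
  · rw [if_neg hij.ne, (hw j).orthogonal _ ⟨i, hij, rfl⟩]
  · rw [if_pos rfl, (hw i).normalized]
  · rw [if_neg hij.ne', h.symm_right, (hw i).orthogonal _ ⟨j, hij, rfl⟩]

theorem apply_sum (h : IsEllipticPair a b) (hw : IsRayleighSequence a b w) {n : ℕ}
    (c : Fin n → ℝ) (i : Fin n) : b (w i) (∑ j, c j • w j) = c i := by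
  simp only [map_sum, map_smul, hw.apply_eq_ite h, Fin.val_inj, smul_eq_mul, mul_ite, mul_one,
    mul_zero, Finset.sum_ite_eq, Finset.mem_univ, if_true]

theorem monotone (hw : IsRayleighSequence a b w) : Monotone fun n => a (w n) (w n) := by
  intro m n hmn
  have := (hw m).le (w n) fun v hv =>
    (hw n).orthogonal v (image_mono (Iio_subset_Iio hmn) hv)
  rwa [(hw n).normalized, mul_one] at this

theorem apply_eq (h : IsEllipticPair a b) (hw : IsRayleighSequence a b w) (n : ℕ) (v : V) :
    a (w n) v = a (w n) (w n) * b (w n) v := by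
  induction n using Nat.strong_induction_on generalizing v with
  | _ n ih =>
    let proj : V := ∑ i : Fin n, b (w i) v • w i
    have horth : ∀ u ∈ w '' Iio n, b u (v - proj) = 0 := by
      rintro _ ⟨i, hi, rfl⟩
      rw [map_sub, sub_eq_zero]
      exact (hw.apply_sum h (fun i : Fin n => b (w i) v) ⟨i, hi⟩).symm
    have hb : b (w n) proj = 0 := by
      simp only [proj, map_sum, map_smul, hw.apply_eq_ite h, Fin.is_lt _ |>.ne', if_false,
        smul_zero, Finset.sum_const_zero]
    have hwi : ∀ i : Fin n, a (w n) (w i) = 0 := fun i => by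
      rw [h.symm_left, ih i i.2, hw.apply_eq_ite h, if_neg i.2.ne, mul_zero]
    have ha : a (w n) proj = 0 := by
      simp only [proj, map_sum, map_smul, hwi, smul_zero, Finset.sum_const_zero]
    simpa only [map_sub, ha, hb, sub_zero] using (hw n).apply_eq h horth

theorem linearIndependent (h : IsEllipticPair a b) (hw : IsRayleighSequence a b w) (n : ℕ) :
    LinearIndependent ℝ fun i : Fin n => w i :=
  Fintype.linearIndependent_iff.2 fun c hc i => by
    rw [← hw.apply_sum h c i, hc, map_zero]

theorem mem_span_of_lt (h : IsEllipticPair a b) (hw : IsRayleighSequence a b w) {u : V} {κ : ℝ}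
    (hu : ∀ v, a u v = κ * b u v) {n : ℕ} (hκ : κ < a (w n) (w n)) :
    u ∈ Submodule.span ℝ (range fun i : Fin n => w i) := by
  let proj : V := ∑ i : Fin n, b (w i) u • w i
  have horth : ∀ i : Fin n, b (w i) (u - proj) = 0 := fun i => by
    rw [map_sub, hw.apply_sum h (fun i : Fin n => b (w i) u), sub_self]
  have hb : b proj (u - proj) = 0 := by
    simp only [proj, map_sum, map_smul, sum_apply, smul_apply, horth, smul_zero,
      Finset.sum_const_zero]
  have ha : a proj (u - proj) = 0 := by
    simp only [proj, map_sum, map_smul, sum_apply, smul_apply, hw.apply_eq h _ (u - _), horth,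
      mul_zero, smul_zero, Finset.sum_const_zero]
  have hself : a (u - proj) (u - proj) = κ * b (u - proj) (u - proj) := by
    rw [map_sub a, map_sub b, sub_apply, sub_apply, ha, hb, hu, sub_zero, sub_zero]
  have hzero : u - proj = 0 := by
    by_contra hne
    have hle := (hw n).le (u - proj) (by rintro _ ⟨i, hi, rfl⟩; exact horth ⟨i, hi⟩)
    rw [hself] at hle
    exact (mul_lt_mul_of_pos_right hκ (h.pos _ hne)).not_ge hle
  rw [sub_eq_zero.1 hzero]
  exact Submodule.sum_mem _ fun i _ => Submodule.smul_mem _ _ (Submodule.subset_span ⟨i, rfl⟩)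

theorem exists_le_of_linearIndependent (h : IsEllipticPair a b) (hw : IsRayleighSequence a b w)
    {n : ℕ} {u : Fin (n + 1) → V} (hu : LinearIndependent ℝ u) {κ : Fin (n + 1) → ℝ}
    (hκ : ∀ i v, a (u i) v = κ i * b (u i) v) : ∃ i, a (w n) (w n) ≤ κ i := by
  classical
  by_contra! hlt
  have hspan : range u ≤ Submodule.span ℝ (range fun i : Fin n => w i) := by
    rintro _ ⟨i, rfl⟩
    exact hw.mem_span_of_lt h (hκ i) (hlt i)
  have hcard := linearIndependent_le_span' u hu _ hspan
  have := hcard.trans (Nat.cast_le.2 (Fintype.card_range_le fun i : Fin n => w i))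
  simp at this

theorem exists_ne_zero_forall_apply_eq_zero_and_le (h : IsEllipticPair a b)
    (hw : IsRayleighSequence a b w) {n : ℕ} (y : Fin n → V) :
    ∃ v ≠ 0, (∀ j, b (y j) v = 0) ∧ a v v ≤ a (w n) (w n) * b v v := by
  let combination : (Fin (n + 1) → ℝ) →ₗ[ℝ] V := Fintype.linearCombination ℝ fun i => w i
  let pairing : V →ₗ[ℝ] (Fin n → ℝ) := LinearMap.pi fun j => (b (y j)).toLinearMap
  have hcomb : ∀ c, combination c = ∑ i, c i • w i := Fintype.linearCombination_apply ℝ _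
  obtain ⟨c, hc, hc0⟩ := Submodule.exists_mem_ne_zero_of_ne_bot
    ((pairing ∘ₗ combination).ker_ne_bot_of_finrank_lt (by simp))
  have hself : ∀ f : V →L[ℝ] V →L[ℝ] ℝ, f (combination c) (combination c) =
      ∑ i, c i * f (w i) (combination c) := fun f => by
    conv_lhs => arg 1; rw [hcomb c]
    simp only [map_sum, map_smul, sum_apply, smul_apply, smul_eq_mul]
  have hb : ∀ i : Fin (n + 1), b (w i) (combination c) = c i := fun i => by
    rw [hcomb, hw.apply_sum h]
  refine ⟨combination c, fun h0 => hc0 (funext fun i => ?_), congrFun hc, ?_⟩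
  · rw [← hb i, h0, map_zero, Pi.zero_apply]
  · simp only [hself, hw.apply_eq h _ (combination c), hb, Finset.mul_sum]
    refine Finset.sum_le_sum fun i _ => ?_
    nlinarith [mul_le_mul_of_nonneg_right (hw.monotone (Nat.lt_succ_iff.1 i.2))
      (mul_self_nonneg (c i))]

/-- The min-max principle: some nonzero vector in the span of `w 0, …, w n` is `b`-orthogonal to
`w' 0, …, w' (n - 1)`. -/
theorem apply_self_le_mul_add (h : IsEllipticPair a b) (hw : IsRayleighSequence a b w)
    (hw' : IsRayleighSequence a' b w') {s δ : ℝ} (hs : 0 ≤ s)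
    (hle : ∀ v, a' v v ≤ s * a v v + δ * b v v) (n : ℕ) :
    a' (w' n) (w' n) ≤ s * a (w n) (w n) + δ := by
  obtain ⟨v, hv, horth, hav⟩ :=
    hw.exists_ne_zero_forall_apply_eq_zero_and_le h fun j : Fin n => w' j
  refine le_of_mul_le_mul_right ?_ (h.pos v hv)
  calc a' (w' n) (w' n) * b v v
      ≤ a' v v := (hw' n).le v (by rintro _ ⟨j, hj, rfl⟩; exact horth ⟨j, hj⟩)
    _ ≤ s * a v v + δ * b v v := hle v
    _ ≤ s * (a (w n) (w n) * b v v) + δ * b v v := by gcongr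
    _ = (s * a (w n) (w n) + δ) * b v v := by ring

end IsRayleighSequence

end EllipticPair

/-! ### The Sobolev space of a metric graph -/

namespace MetricGraph

variable {E : Type*} (G : MetricGraph E)

theorem pt_projIcc (e : E) (t : ℝ) :
    G.pt e (projIcc 0 (G.len e) (G.len_pos e).le t) = G.pt e t := by
  simp only [pt, projIcc_val]
  rfl

theorem exists_pt_eq (x : G.Point) : ∃ e, ∃ t ∈ Icc 0 (G.len e), G.pt e t = x := by
  obtain ⟨⟨e, t, ht⟩, rfl⟩ := Quotient.exists_rep x
  exact ⟨e, t, ht, by rw [pt, projIcc_of_mem _ ht]⟩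

theorem continuous_pt (e : E) : Continuous (G.pt e) := by
  have hmk : Continuous fun x : Icc (0 : ℝ) (G.len e) => (⟨e, x⟩ : G.PrePoint) :=
    continuous_sigmaMk (σ := fun e : E => Icc (0 : ℝ) (G.len e))
  exact continuous_quotient_mk'.comp (hmk.comp continuous_projIcc)

variable {G} in
theorem continuous_iff_forall_comp_pt {X : Type*} [TopologicalSpace X] {f : G.Point → X} :
    Continuous f ↔ ∀ e, Continuous fun t => f (G.pt e t) := by
  refine ⟨fun hf e => hf.comp (G.continuous_pt e), fun hf => ?_⟩
  refine isQuotientMap_quotient_mk'.continuous_iff.2 (continuous_sigma fun e => ?_)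
  refine ((hf e).comp continuous_subtype_val).congr fun t => ?_
  simp only [Function.comp_apply, pt, projIcc_val]
  rfl

instance [Finite E] : CompactSpace G.Point := inferInstanceAs (CompactSpace (Quotient G.glue))

instance (e : E) : IsFiniteMeasure (G.edgeMeasure e) := by
  unfold edgeMeasure
  infer_instance

theorem ae_edgeMeasure_iff {e : E} {p : ℝ → Prop} :
    (∀ᵐ t ∂(G.edgeMeasure e), p t) ↔ ∀ᵐ t, t ∈ Ioo 0 (G.len e) → p t := by
  rw [edgeMeasure, ← restrict_Ioo_eq_restrict_Icc, ae_restrict_iff' measurableSet_Ioo]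

theorem edgeMeasure_real_univ (e : E) : (G.edgeMeasure e).real univ = G.len e := by
  simp [edgeMeasure, (G.len_pos e).le]

theorem integral_edgeMeasure (e : E) (f : ℝ → ℝ) :
    ∫ t, f t ∂(G.edgeMeasure e) = ∫ t in (0 : ℝ)..G.len e, f t := by
  rw [intervalIntegral.integral_of_le (G.len_pos e).le, edgeMeasure, integral_Icc_eq_integral_Ioc]

theorem restrict_edgeMeasure {e : E} {s t : ℝ} (hs : 0 ≤ s) (ht : t ≤ G.len e) :
    (G.edgeMeasure e).restrict (Ioc s t) = volume.restrict (Ioc s t) :=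
  Measure.restrict_restrict_of_subset fun _ hx => ⟨hs.trans hx.1.le, hx.2.trans ht⟩

theorem integrable_edgeMeasure_of_continuous {f : ℝ → ℝ} (hf : Continuous f) (e : E) :
    Integrable f (G.edgeMeasure e) :=
  hf.continuousOn.integrableOn_Icc

/-- Integration over `(s, t]`, as a continuous linear functional on the `L²` space of an edge. -/
noncomputable def integralCLM (e : E) (s t : ℝ) : Lp ℝ 2 (G.edgeMeasure e) →L[ℝ] ℝ :=
  innerSL ℝ (indicatorConstLp 2 (measurableSet_Ioc : MeasurableSet (Ioc s t))
    (measure_ne_top (G.edgeMeasure e) _) (1 : ℝ))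

variable {G}

theorem integralCLM_apply {e : E} {s t : ℝ} (hs : 0 ≤ s) (hst : s ≤ t) (ht : t ≤ G.len e)
    (f : Lp ℝ 2 (G.edgeMeasure e)) : G.integralCLM e s t f = ∫ r in s..t, f r := by
  rw [integralCLM, innerSL_apply_apply, L2.inner_indicatorConstLp_one,
    G.restrict_edgeMeasure hs ht, intervalIntegral.integral_of_le hst]

theorem abs_integralCLM_le {e : E} {s t : ℝ} (hst : s ≤ t) (f : Lp ℝ 2 (G.edgeMeasure e)) :
    |G.integralCLM e s t f| ≤ √(t - s) * ‖f‖ := by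
  rw [integralCLM, innerSL_apply_apply]
  refine (abs_real_inner_le_norm _ _).trans ?_
  gcongr
  rw [norm_indicatorConstLp (by simp) (by simp), Real.sqrt_eq_rpow, norm_one, one_mul]
  refine Real.rpow_le_rpow measureReal_nonneg ?_ (by norm_num)
  calc (G.edgeMeasure e).real (Ioc s t)
      ≤ volume.real (Ioc s t) := ENNReal.toReal_mono (by simp) (Measure.restrict_apply_le _ _)
    _ = t - s := Real.volume_real_Ioc_of_le hst

theorem intervalIntegrable_of_Lp {e : E} {s t : ℝ} (hs : 0 ≤ s) (hst : s ≤ t) (ht : t ≤ G.len e)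
    (f : Lp ℝ 2 (G.edgeMeasure e)) : IntervalIntegrable f volume s t := by
  rw [intervalIntegrable_iff_integrableOn_Ioc_of_le hst, IntegrableOn,
    ← G.restrict_edgeMeasure hs ht]
  exact ((Lp.memLp f).integrable one_le_two).restrict

variable (G) in
/-- The subspace underlying the Sobolev space `H¹`: the pairs of a continuous function on the graph
and its edgewise weak derivative. -/
noncomputable def sobolevSubmodule :
    Submodule ℝ (C(G.Point, ℝ) × ∀ e, Lp ℝ 2 (G.edgeMeasure e)) where
  carrier := {p | ∀ e, ∀ t ∈ Icc 0 (G.len e),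
    p.1 (G.pt e t) = p.1 (G.pt e 0) + G.integralCLM e 0 t (p.2 e)}
  add_mem' := by
    intro p q hp hq e t ht
    simp only [Prod.fst_add, Prod.snd_add, Pi.add_apply, map_add, ContinuousMap.add_apply,
      hp e t ht, hq e t ht]
    ring
  zero_mem' := by simp
  smul_mem' := by
    intro c p hp e t ht
    simp only [Prod.smul_fst, Prod.smul_snd, Pi.smul_apply, map_smul, ContinuousMap.smul_apply,
      hp e t ht, smul_eq_mul, mul_add]

variable (G) in
theorem isClosed_sobolevSubmodule : IsClosed (G.sobolevSubmodule : Set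
    (C(G.Point, ℝ) × ∀ e, Lp ℝ 2 (G.edgeMeasure e))) := by
  change IsClosed {p : C(G.Point, ℝ) × ∀ e, Lp ℝ 2 (G.edgeMeasure e) | ∀ e, ∀ t ∈ Icc 0 (G.len e),
    p.1 (G.pt e t) = p.1 (G.pt e 0) + G.integralCLM e 0 t (p.2 e)}
  simp only [ofPred_forall]
  exact isClosed_iInter fun e => isClosed_iInter fun t => isClosed_iInter fun _ =>
    isClosed_eq (by fun_prop) (by fun_prop)

variable (G) in
/-- The Sobolev space `H¹` of the graph, normed by the supremum norm of the function together with
the `L²` norms of its derivatives on the edges. -/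
def Sobolev : Type _ := G.sobolevSubmodule

namespace Sobolev

variable [Fintype E]

noncomputable instance : NormedAddCommGroup G.Sobolev :=
  inferInstanceAs (NormedAddCommGroup G.sobolevSubmodule)

noncomputable instance : NormedSpace ℝ G.Sobolev :=
  inferInstanceAs (NormedSpace ℝ G.sobolevSubmodule)

instance : CompleteSpace G.Sobolev :=
  G.isClosed_sobolevSubmodule.completeSpace_coe

/-- The continuous function underlying an element of `H¹`. -/
noncomputable def value : G.Sobolev →L[ℝ] C(G.Point, ℝ) :=
  (ContinuousLinearMap.fst ℝ _ _).comp G.sobolevSubmodule.subtypeL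

/-- The weak derivative of an element of `H¹` on an edge. -/
noncomputable def grad (e : E) : G.Sobolev →L[ℝ] Lp ℝ 2 (G.edgeMeasure e) :=
  ((ContinuousLinearMap.proj e).comp (ContinuousLinearMap.snd ℝ _ _)).comp
    G.sobolevSubmodule.subtypeL

theorem value_pt (v : G.Sobolev) {e : E} {t : ℝ} (ht : t ∈ Icc 0 (G.len e)) :
    value v (G.pt e t) = value v (G.pt e 0) + ∫ s in (0 : ℝ)..t, grad e v s := by
  rw [← integralCLM_apply le_rfl ht.1 ht.2]
  exact v.2 e t ht

theorem value_pt_sub_value_pt (v : G.Sobolev) {e : E} {s t : ℝ} (hs : 0 ≤ s) (hst : s ≤ t)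
    (ht : t ≤ G.len e) :
    value v (G.pt e t) - value v (G.pt e s) = G.integralCLM e s t (grad e v) := by
  rw [value_pt v ⟨hs, hst.trans ht⟩, value_pt v ⟨hs.trans hst, ht⟩, integralCLM_apply hs hst ht,
    ← intervalIntegral.integral_add_adjacent_intervals
      (intervalIntegrable_of_Lp le_rfl hs (hst.trans ht) _) (intervalIntegrable_of_Lp hs hst ht _)]
  ring

theorem dist_value_pt_le (v : G.Sobolev) (e : E) (s t : ℝ) :
    dist (value v (G.pt e s)) (value v (G.pt e t)) ≤ √(dist s t) * ‖grad e v‖ := by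
  rw [← G.pt_projIcc e t, ← G.pt_projIcc e s]
  have hproj : dist (projIcc 0 (G.len e) (G.len_pos e).le s : ℝ)
      (projIcc 0 (G.len e) (G.len_pos e).le t) ≤ dist s t :=
    abs_projIcc_sub_projIcc (G.len_pos e).le
  refine le_trans ?_ (mul_le_mul_of_nonneg_right (Real.sqrt_le_sqrt hproj) (norm_nonneg _))
  generalize projIcc 0 (G.len e) (G.len_pos e).le s = s'
  generalize projIcc 0 (G.len e) (G.len_pos e).le t = t'
  wlog hst : (s' : ℝ) ≤ t' generalizing s' t'
  · rw [dist_comm (value v _), dist_comm (s' : ℝ)]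
    exact this t' s' (le_of_not_ge hst)
  rw [dist_comm, dist_comm (s' : ℝ), Real.dist_eq, Real.dist_eq,
    value_pt_sub_value_pt v s'.2.1 hst t'.2.2, abs_of_nonneg (sub_nonneg.2 hst)]
  exact abs_integralCLM_le hst _

theorem grad_eq_zero {v : G.Sobolev} (hv : value v = 0) (e : E) : grad e v = 0 := by
  have hl := (G.len_pos e).le
  have hder := (intervalIntegrable_of_Lp le_rfl hl le_rfl (grad e v)).ae_hasDerivAt_integral
  rw [Lp.eq_zero_iff_ae_eq_zero, EventuallyEq, ae_edgeMeasure_iff]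
  filter_upwards [hder] with t ht htI
  have hsub := Ioo_subset_Icc_self htI
  rw [uIcc_of_le hl] at ht
  refine (ht hsub 0 (left_mem_Icc.2 hl)).unique
    ((hasDerivAt_const t (0 : ℝ)).congr_of_eventuallyEq ?_)
  filter_upwards [isOpen_Ioo.mem_nhds htI] with s hs
  simpa [hv] using (value_pt v (Ioo_subset_Icc_self hs)).symm

theorem eq_zero_of_value_eq_zero {v : G.Sobolev} (hv : value v = 0) : v = 0 :=
  Subtype.ext (Prod.ext hv (funext fun e => grad_eq_zero hv e))

end Sobolev

/-- A bounded measurable function on the graph. -/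
structure IsBoundedPotential (ρ : G.Point → ℝ) : Prop where
  aestronglyMeasurable : ∀ e, AEStronglyMeasurable (fun t => ρ (G.pt e t)) (G.edgeMeasure e)
  bounded : ∃ C, ∀ x, |ρ x| ≤ C

theorem abs_le_of_mem_boundedClass {M : ℝ} {ρ : G.Point → ℝ} (hρ : ρ ∈ G.boundedClass M)
    (x : G.Point) : |ρ x| ≤ M := by
  rw [abs_of_nonneg (hρ.2 x).1]
  exact (hρ.2 x).2

theorem isBoundedPotential_of_mem_boundedClass {M : ℝ} {ρ : G.Point → ℝ}
    (hρ : ρ ∈ G.boundedClass M) : IsBoundedPotential ρ :=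
  ⟨hρ.1, M, abs_le_of_mem_boundedClass hρ⟩

namespace IsBoundedPotential

variable {ρ : G.Point → ℝ}

theorem const (c : ℝ) : IsBoundedPotential fun _ : G.Point => c :=
  ⟨fun _ => aestronglyMeasurable_const, |c|, fun _ => le_rfl⟩

theorem integrable_mul (hρ : IsBoundedPotential ρ) {e : E} {f : ℝ → ℝ}
    (hf : Integrable f (G.edgeMeasure e)) :
    Integrable (fun t => ρ (G.pt e t) * f t) (G.edgeMeasure e) := by
  obtain ⟨C, hC⟩ := hρ.bounded
  exact hf.bdd_mul (hρ.aestronglyMeasurable e) (.of_forall fun t => hC _)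

theorem integrable_mul_continuous (hρ : IsBoundedPotential ρ) (e : E) (f : C(G.Point, ℝ)) :
    Integrable (fun t => ρ (G.pt e t) * f (G.pt e t)) (G.edgeMeasure e) :=
  hρ.integrable_mul
    (G.integrable_edgeMeasure_of_continuous (f.continuous.comp (G.continuous_pt e)) e)

variable [Fintype E]

theorem abs_sum_integral_le {C : ℝ} (hC : ∀ x, |ρ x| ≤ C) (f : C(G.Point, ℝ)) :
    |∑ e, ∫ t, ρ (G.pt e t) * f (G.pt e t) ∂(G.edgeMeasure e)| ≤ C * (∑ e, G.len e) * ‖f‖ := by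
  calc |∑ e, ∫ t, ρ (G.pt e t) * f (G.pt e t) ∂(G.edgeMeasure e)|
      ≤ ∑ e, |∫ t, ρ (G.pt e t) * f (G.pt e t) ∂(G.edgeMeasure e)| := Finset.abs_sum_le_sum_abs _ _
    _ ≤ ∑ e, C * ‖f‖ * (G.edgeMeasure e).real univ := by
      refine Finset.sum_le_sum fun e _ => (Real.norm_eq_abs _).symm.trans_le <|
        norm_integral_le_of_norm_le_const (.of_forall fun t => ?_)
      rw [norm_mul]
      exact mul_le_mul (hC _) (f.norm_coe_le_norm _) (norm_nonneg _)
        ((abs_nonneg _).trans (hC (G.pt e t)))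
    _ = C * (∑ e, G.len e) * ‖f‖ := by
      simp only [edgeMeasure_real_univ, ← Finset.mul_sum]
      ring

/-- The functional `f ↦ ∫ ρ f` on the continuous functions on the graph. -/
noncomputable def integral (hρ : IsBoundedPotential ρ) : C(G.Point, ℝ) →L[ℝ] ℝ :=
  LinearMap.mkContinuousOfExistsBound
    { toFun := fun f => ∑ e, ∫ t, ρ (G.pt e t) * f (G.pt e t) ∂(G.edgeMeasure e)
      map_add' := fun f g => by
        simp only [ContinuousMap.add_apply, mul_add, integral_add
          (hρ.integrable_mul_continuous _ f) (hρ.integrable_mul_continuous _ g),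
          Finset.sum_add_distrib]
      map_smul' := fun c f => by
        simp only [ContinuousMap.smul_apply, smul_eq_mul, mul_left_comm, integral_const_mul,
          Finset.mul_sum, RingHom.id_apply] }
    (hρ.bounded.imp' (· * ∑ e, G.len e) fun _ hC f => abs_sum_integral_le hC f)

theorem integral_apply (hρ : IsBoundedPotential ρ) (f : C(G.Point, ℝ)) :
    hρ.integral f = ∑ e, ∫ t, ρ (G.pt e t) * f (G.pt e t) ∂(G.edgeMeasure e) := rfl

theorem abs_integral_le (hρ : IsBoundedPotential ρ) {C : ℝ} (hC : ∀ x, |ρ x| ≤ C)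
    (f : C(G.Point, ℝ)) : |hρ.integral f| ≤ C * (∑ e, G.len e) * ‖f‖ :=
  abs_sum_integral_le hC f

end IsBoundedPotential

namespace Sobolev

variable [Fintype E] {ρ : G.Point → ℝ}

/-- The Dirichlet form `∫ u' v'`. -/
noncomputable def dirichlet : G.Sobolev →L[ℝ] G.Sobolev →L[ℝ] ℝ :=
  ∑ e, (innerSL ℝ : Lp ℝ 2 (G.edgeMeasure e) →L[ℝ] _ →L[ℝ] ℝ).bilinearComp (grad e) (grad e)

theorem dirichlet_apply (u v : G.Sobolev) :
    dirichlet u v = ∑ e, inner ℝ (grad e u) (grad e v) := by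
  simp only [dirichlet, sum_apply, ContinuousLinearMap.bilinearComp_apply]
  rfl

/-- The form `∫ ρ u v`. -/
noncomputable def weight (hρ : IsBoundedPotential ρ) : G.Sobolev →L[ℝ] G.Sobolev →L[ℝ] ℝ :=
  ((ContinuousLinearMap.compL ℝ _ _ _ hρ.integral).comp
    (ContinuousLinearMap.mul ℝ C(G.Point, ℝ))).bilinearComp value value

theorem weight_eq_integral (hρ : IsBoundedPotential ρ) (u v : G.Sobolev) :
    weight hρ u v = hρ.integral (value u * value v) := rfl

theorem weight_apply (hρ : IsBoundedPotential ρ) (u v : G.Sobolev) :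
    weight hρ u v = ∑ e, ∫ t, ρ (G.pt e t) * (value u (G.pt e t) * value v (G.pt e t))
      ∂(G.edgeMeasure e) := rfl

/-- The `L²` inner product. -/
noncomputable def mass : G.Sobolev →L[ℝ] G.Sobolev →L[ℝ] ℝ := weight (.const 1)

theorem mass_apply (u v : G.Sobolev) :
    mass u v = ∑ e, ∫ t, value u (G.pt e t) * value v (G.pt e t) ∂(G.edgeMeasure e) := by
  simp only [mass, weight_apply, one_mul]

/-- The quadratic form `∫ u' v' + ∫ ρ u v` of the Schrödinger operator with potential `ρ`. -/
noncomputable def schrodinger (hρ : IsBoundedPotential ρ) : G.Sobolev →L[ℝ] G.Sobolev →L[ℝ] ℝ :=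
  dirichlet + weight hρ

theorem schrodinger_apply (hρ : IsBoundedPotential ρ) (u v : G.Sobolev) :
    schrodinger hρ u v = dirichlet u v + weight hρ u v := rfl

theorem dirichlet_symm (u v : G.Sobolev) : dirichlet u v = dirichlet v u := by
  simp only [dirichlet_apply, real_inner_comm]

theorem weight_symm (hρ : IsBoundedPotential ρ) (u v : G.Sobolev) :
    weight hρ u v = weight hρ v u := by
  rw [weight_eq_integral, weight_eq_integral, mul_comm]

theorem mass_symm (u v : G.Sobolev) : mass u v = mass v u := weight_symm _ u v

theorem norm_grad_sq_le (v : G.Sobolev) (e : E) : ‖grad e v‖ ^ 2 ≤ dirichlet v v := by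
  rw [dirichlet_apply, ← real_inner_self_eq_norm_sq]
  exact Finset.single_le_sum (f := fun e => inner ℝ (grad e v) (grad e v))
    (fun _ _ => real_inner_self_nonneg) (Finset.mem_univ e)

theorem dirichlet_nonneg (v : G.Sobolev) : 0 ≤ dirichlet v v := by
  rw [dirichlet_apply]
  exact Finset.sum_nonneg fun _ _ => real_inner_self_nonneg

theorem integral_sq_le_mass (v : G.Sobolev) (e : E) :
    ∫ t, value v (G.pt e t) * value v (G.pt e t) ∂(G.edgeMeasure e) ≤ mass v v := by
  rw [mass_apply]
  exact Finset.single_le_sum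
    (f := fun e => ∫ t, value v (G.pt e t) * value v (G.pt e t) ∂(G.edgeMeasure e))
    (fun _ _ => integral_nonneg fun _ => mul_self_nonneg _) (Finset.mem_univ e)

theorem mass_nonneg (v : G.Sobolev) : 0 ≤ mass v v := by
  rw [mass_apply]
  exact Finset.sum_nonneg fun _ _ => integral_nonneg fun _ => mul_self_nonneg _

theorem mass_pos {v : G.Sobolev} (hv : v ≠ 0) : 0 < mass v v := by
  refine (mass_nonneg v).lt_of_ne fun h0 => hv (eq_zero_of_value_eq_zero ?_)
  ext x
  obtain ⟨e, t, ht, rfl⟩ := G.exists_pt_eq x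
  have hcont : Continuous fun t => value v (G.pt e t) * value v (G.pt e t) := by
    have := G.continuous_pt e
    fun_prop
  have hzero := (integral_eq_zero_iff_of_nonneg (fun _ => mul_self_nonneg _)
    (G.integrable_edgeMeasure_of_continuous hcont e)).1
      (((integral_sq_le_mass v e).trans h0.ge).antisymm
        (integral_nonneg fun _ => mul_self_nonneg _))
  have := Measure.eqOn_Icc_of_ae_eq volume (G.len_pos e).ne hzero hcont.continuousOn
    continuousOn_const ht
  exact mul_self_eq_zero.1 this

theorem abs_weight_self_le (hρ : IsBoundedPotential ρ) {C : ℝ} (hC : ∀ x, |ρ x| ≤ C)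
    (v : G.Sobolev) : |weight hρ v v| ≤ C * mass v v := by
  rw [weight_apply, mass_apply, Finset.mul_sum]
  refine (Finset.abs_sum_le_sum_abs _ _).trans (Finset.sum_le_sum fun e _ => ?_)
  rw [← integral_const_mul]
  refine (Real.norm_eq_abs _).symm.trans_le <|
    norm_integral_le_of_norm_le ?_ (.of_forall fun t => ?_)
  · exact (IsBoundedPotential.const C).integrable_mul_continuous e (value v * value v)
  · rw [norm_mul, Real.norm_of_nonneg (mul_self_nonneg (value v _))]
    exact mul_le_mul_of_nonneg_right (hC _) (mul_self_nonneg _)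

/-- Averaging `u(t) = u(s) + ∫ u'` over `s` in an edge. -/
theorem len_mul_sq_value_pt_le (v : G.Sobolev) {e : E} {t : ℝ} (ht : t ∈ Icc 0 (G.len e)) :
    G.len e * value v (G.pt e t) ^ 2 ≤ 2 * mass v v + 2 * G.len e ^ 2 * dirichlet v v := by
  have hl := G.len_pos e
  have hpt : ∀ s ∈ Icc 0 (G.len e), value v (G.pt e t) ^ 2 ≤
      2 * (value v (G.pt e s) * value v (G.pt e s)) + 2 * (G.len e * dirichlet v v) := by
    intro s hs
    have hosc : (value v (G.pt e s) - value v (G.pt e t)) ^ 2 ≤ G.len e * dirichlet v v :=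
      calc (value v (G.pt e s) - value v (G.pt e t)) ^ 2
          ≤ (√(dist s t) * ‖grad e v‖) ^ 2 := by
            rw [← sq_abs]
            gcongr
            exact dist_value_pt_le v e s t
        _ = dist s t * ‖grad e v‖ ^ 2 := by rw [mul_pow, Real.sq_sqrt dist_nonneg]
        _ ≤ G.len e * dirichlet v v := by
            gcongr
            · simpa using Real.dist_le_of_mem_Icc hs ht
            · exact norm_grad_sq_le v e
    nlinarith [sq_nonneg (value v (G.pt e t) - 2 * value v (G.pt e s))]
  have hsq : Integrable (fun s => value v (G.pt e s) * value v (G.pt e s)) (G.edgeMeasure e) := by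
    simpa only [one_mul, ContinuousMap.mul_apply] using
      (IsBoundedPotential.const 1).integrable_mul_continuous e (value v * value v)
  have hint := integral_mono_ae (integrable_const _) ((hsq.const_mul 2).add (integrable_const _))
    ((ae_restrict_iff' measurableSet_Icc).2 (.of_forall hpt))
  simp only [Pi.add_apply] at hint
  rw [integral_const, integral_add (hsq.const_mul 2) (integrable_const _), integral_const,
    integral_const_mul, edgeMeasure_real_univ, smul_eq_mul, smul_eq_mul] at hint
  linarith [integral_sq_le_mass v e]

variable (G) in
theorem exists_sq_value_le : ∃ C, 0 ≤ C ∧ ∀ (v : G.Sobolev) (x : G.Point),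
    value v x ^ 2 ≤ C * (dirichlet v v + mass v v) := by
  have hnonneg : ∀ e ∈ Finset.univ, 0 ≤ 2 / G.len e + 2 * G.len e := fun e _ => by
    have := G.len_pos e
    positivity
  refine ⟨∑ e, (2 / G.len e + 2 * G.len e), Finset.sum_nonneg hnonneg, fun v x => ?_⟩
  obtain ⟨e, t, ht, rfl⟩ := G.exists_pt_eq x
  have hl := G.len_pos e
  have hd := dirichlet_nonneg v
  have hm := mass_nonneg v
  calc value v (G.pt e t) ^ 2 ≤ (2 / G.len e + 2 * G.len e) * (dirichlet v v + mass v v) := by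
        refine le_of_mul_le_mul_left ((len_mul_sq_value_pt_le v ht).trans ?_) hl
        field_simp
        nlinarith [mul_nonneg (sq_nonneg (G.len e)) hm]
    _ ≤ _ := mul_le_mul_of_nonneg_right (Finset.single_le_sum hnonneg (Finset.mem_univ e))
        (add_nonneg hd hm)

variable (G) in
theorem exists_norm_sq_le : ∃ C > 0, ∀ v : G.Sobolev, ‖v‖ ^ 2 ≤ C * (dirichlet v v + mass v v) := by
  obtain ⟨C, hC, hsup⟩ := exists_sq_value_le G
  refine ⟨C + 1, by positivity, fun v => ?_⟩
  have hd := dirichlet_nonneg v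
  have hm := mass_nonneg v
  have hCN : 0 ≤ C * (dirichlet v v + mass v v) := by positivity
  refine (Real.le_sqrt (norm_nonneg v) (by positivity)).1 (max_le ?_ ?_)
  · refine (ContinuousMap.norm_le (value v) (Real.sqrt_nonneg _)).2 fun x => Real.abs_le_sqrt ?_
    linarith [hsup v x]
  · refine (pi_norm_le_iff_of_nonneg (x := fun e => grad e v) (Real.sqrt_nonneg _)).2 fun e =>
      Real.le_sqrt_of_sq_le ?_
    linarith [norm_grad_sq_le v e]

theorem norm_value_le (v : G.Sobolev) : ‖value v‖ ≤ ‖v‖ := le_max_left _ _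

theorem norm_grad_le (v : G.Sobolev) (e : E) : ‖grad e v‖ ≤ ‖v‖ :=
  (norm_le_pi_norm v.1.2 e).trans (le_max_right _ _)

variable (G) in
theorem equicontinuous_value (R : ℝ) :
    Equicontinuous fun v : {v : G.Sobolev // ‖v‖ ≤ R} => ⇑(value v.1) := by
  rw [equicontinuous_iff_continuous, continuous_iff_forall_comp_pt]
  intro e
  have hlim : Tendsto (fun r : ℝ => √r * R) (𝓝 0) (𝓝 0) := by
    have : Continuous fun r : ℝ => √r * R := by fun_prop
    simpa using this.tendsto 0
  refine (equicontinuous_iff_continuous (F := fun v : {v : G.Sobolev // ‖v‖ ≤ R} =>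
    fun t => value v.1 (G.pt e t))).1 (Metric.equicontinuous_of_continuity_modulus _ hlim _
      fun s t v => (dist_value_pt_le v.1 e s t).trans ?_)
  gcongr
  exact (norm_grad_le v.1 e).trans v.2

theorem exists_subseq_tendsto_value {x : ℕ → G.Sobolev} {R : ℝ} (hx : ∀ n, ‖x n‖ ≤ R) :
    ∃ (φ : ℕ → ℕ) (u : C(G.Point, ℝ)), StrictMono φ ∧
      Tendsto (fun n => value (x (φ n))) atTop (𝓝 u) := by
  let f (n : ℕ) : BoundedContinuousFunction G.Point ℝ := .mkOfCompact (value (x n))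
  have hcompact : IsCompact (closure (range f)) := by
    refine BoundedContinuousFunction.arzela_ascoli (Icc (-R) R) isCompact_Icc _ ?_ ?_
    · rintro _ y ⟨n, rfl⟩
      exact abs_le.1 (((value (x n)).norm_coe_le_norm y).trans ((norm_value_le _).trans (hx n)))
    · rintro y ε hε
      filter_upwards [equicontinuous_value G R y ε hε] with z hz
      rintro ⟨_, n, rfl⟩
      exact hz ⟨x n, hx n⟩
  obtain ⟨u, -, φ, hφ, hu⟩ := hcompact.tendsto_subseq fun n => subset_closure (mem_range_self n)
  refine ⟨φ, u.toContinuousMap, hφ, ContinuousMap.tendsto_iff_tendstoUniformly.2 ?_⟩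
  exact BoundedContinuousFunction.tendsto_iff_tendstoUniformly.1 hu

theorem tendsto_mass_sub_of_tendsto_value {x : ℕ → G.Sobolev} {u : C(G.Point, ℝ)}
    (hx : Tendsto (fun n => value (x n)) atTop (𝓝 u)) :
    Tendsto (fun p : ℕ × ℕ => mass (x p.1 - x p.2) (x p.1 - x p.2)) atTop (𝓝 0) := by
  have hdiff : Tendsto (fun p : ℕ × ℕ => value (x p.1 - x p.2)) atTop (𝓝 0) := by
    rw [← prod_atTop_atTop_eq]
    simpa using (hx.comp tendsto_fst).sub (hx.comp tendsto_snd)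
  simp only [mass, weight_eq_integral]
  have hcont := (IsBoundedPotential.integral (G := G) (.const 1)).continuous.tendsto (0 * 0)
  rw [mul_zero, map_zero] at hcont
  exact hcont.comp (by simpa only [mul_zero] using hdiff.mul hdiff)

theorem isEllipticPair (hρ : IsBoundedPotential ρ) : IsEllipticPair (schrodinger hρ) mass where
  symm_left u v := by rw [schrodinger_apply, dirichlet_symm, weight_symm, ← schrodinger_apply]
  symm_right := mass_symm
  pos _ := mass_pos
  coercive := by
    obtain ⟨C, hC⟩ := hρ.bounded
    obtain ⟨B, hB, hle⟩ := exists_norm_sq_le G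
    refine ⟨B⁻¹, inv_pos.2 hB, 1 + C, fun v => ?_⟩
    have := (inv_mul_le_iff₀ hB).2 (hle v)
    have := abs_le.1 (abs_weight_self_le hρ hC v)
    rw [schrodinger_apply]
    linarith
  compact x R hx := by
    obtain ⟨φ, u, hφ, hu⟩ := exists_subseq_tendsto_value hx
    exact ⟨φ, hφ, tendsto_mass_sub_of_tendsto_value (x := fun n => x (φ n)) hu⟩

end Sobolev

end MetricGraph

/-! ### Eigenfunctions as weak solutions -/

theorem integral_mul_add_mul_of_primitives {f f₁ g g₁ : ℝ → ℝ} {l : ℝ} (hl : 0 ≤ l)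
    (hf₁ : IntervalIntegrable f₁ volume 0 l) (hg₁ : IntervalIntegrable g₁ volume 0 l)
    (hf : ∀ t ∈ Icc 0 l, f t = f 0 + ∫ s in (0 : ℝ)..t, f₁ s)
    (hg : ∀ t ∈ Icc 0 l, g t = g 0 + ∫ s in (0 : ℝ)..t, g₁ s) :
    ∫ t in (0 : ℝ)..l, (f t * g₁ t + f₁ t * g t) = f l * g l - f 0 * g 0 := by
  have hac (c : ℝ) {f : ℝ → ℝ} (hf : IntervalIntegrable f volume 0 l) :
      AbsolutelyContinuousOnInterval (fun t => c + ∫ s in (0 : ℝ)..t, f s) 0 l :=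
    (LipschitzWith.const c).lipschitzOnWith.absolutelyContinuousOnInterval.add
      (hf.absolutelyContinuousOnInterval_intervalIntegral (c := 0) left_mem_uIcc)
  have hparts := (hac (f 0) hf₁).integral_deriv_mul_eq_sub (hac (g 0) hg₁)
  rw [← hf l ⟨hl, le_rfl⟩, ← hg l ⟨hl, le_rfl⟩, intervalIntegral.integral_same, add_zero,
    intervalIntegral.integral_same, add_zero] at hparts
  rw [← hparts]
  refine intervalIntegral.integral_congr_ae ?_
  filter_upwards [hf₁.ae_hasDerivAt_integral, hg₁.ae_hasDerivAt_integral] with t hft hgt ht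
  have htu : t ∈ uIcc 0 l := uIoc_subset_uIcc ht
  have htI : t ∈ Icc 0 l := uIcc_of_le hl ▸ htu
  rw [((hft htu 0 left_mem_uIcc).const_add _).deriv, ((hgt htu 0 left_mem_uIcc).const_add _).deriv,
    ← hf t htI, ← hg t htI]
  ring

namespace MetricGraph

variable {E : Type*} {G : MetricGraph E}

section Edge

variable {e : E}

theorem intervalIntegrable_of_integrable_edgeMeasure {f : ℝ → ℝ}
    (hf : Integrable f (G.edgeMeasure e)) {s t : ℝ} (hs : s ∈ Icc 0 (G.len e))
    (ht : t ∈ Icc 0 (G.len e)) : IntervalIntegrable f volume s t :=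
  intervalIntegrable_iff.2
    (IntegrableOn.mono_set hf (uIoc_subset_uIcc.trans (uIcc_subset_Icc hs ht)))

theorem continuousOn_primitive_of_integrable_edgeMeasure {f : ℝ → ℝ}
    (hf : Integrable f (G.edgeMeasure e)) :
    ContinuousOn (fun t => ∫ s in (0 : ℝ)..t, f s) (Icc 0 (G.len e)) := by
  rw [← uIcc_of_le (G.len_pos e).le]
  refine intervalIntegral.continuousOn_primitive_interval ?_
  rwa [uIcc_of_le (G.len_pos e).le]

theorem memLp_edgeMeasure_of_continuousOn {f : ℝ → ℝ} (hf : ContinuousOn f (Icc 0 (G.len e))) :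
    MemLp f 2 (G.edgeMeasure e) := by
  obtain ⟨C, hC⟩ := isCompact_Icc.exists_bound_of_continuousOn hf
  refine MemLp.of_bound (hf.aestronglyMeasurable measurableSet_Icc) C ?_
  filter_upwards [ae_restrict_mem measurableSet_Icc] with t ht using hC t ht

theorem integralCLM_eq_of_ae_eq {f : Lp ℝ 2 (G.edgeMeasure e)} {g : ℝ → ℝ}
    (hfg : f =ᵐ[G.edgeMeasure e] g) {s t : ℝ} (hs : 0 ≤ s) (hst : s ≤ t) (ht : t ≤ G.len e) :
    G.integralCLM e s t f = ∫ r in s..t, g r := by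
  rw [integralCLM_apply hs hst ht, intervalIntegral.integral_of_le hst,
    intervalIntegral.integral_of_le hst, ← G.restrict_edgeMeasure hs ht]
  exact integral_congr_ae (ae_restrict_of_ae hfg)

theorem integralCLM_const (c : ℝ) :
    G.integralCLM e 0 (G.len e) (Lp.const 2 (G.edgeMeasure e) c) = G.len e * c := by
  rw [integralCLM_eq_of_ae_eq (Lp.coeFn_const ..) le_rfl (G.len_pos e).le le_rfl]
  simp

theorem inner_Lp_const (f : Lp ℝ 2 (G.edgeMeasure e)) (c : ℝ) :
    inner ℝ f (Lp.const 2 (G.edgeMeasure e) c) = c * G.integralCLM e 0 (G.len e) f := by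
  rw [integralCLM_apply le_rfl (G.len_pos e).le le_rfl, ← integral_edgeMeasure,
    ← integral_const_mul, L2.inner_def]
  refine integral_congr_ae ?_
  filter_upwards [Lp.coeFn_const 2 (G.edgeMeasure e) c] with t ht
  rw [ht]
  simp

theorem not_finite_Lp_edgeMeasure : ¬ Module.Finite ℝ (Lp ℝ 2 (G.edgeMeasure e)) := by
  have hmem (p : Polynomial ℝ) : MemLp (fun t => p.eval t) 2 (G.edgeMeasure e) :=
    memLp_edgeMeasure_of_continuousOn p.continuous.continuousOn
  let toLp : Polynomial ℝ →ₗ[ℝ] Lp ℝ 2 (G.edgeMeasure e) :=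
    { toFun := fun p => (hmem p).toLp
      map_add' := fun p q => by
        rw [← MemLp.toLp_add]
        simp only [Polynomial.eval_add]
        rfl
      map_smul' := fun c p => by
        rw [RingHom.id_apply, ← MemLp.toLp_const_smul]
        simp only [Polynomial.eval_smul]
        rfl }
  have hinj : Function.Injective toLp := by
    refine (injective_iff_map_eq_zero toLp).2 fun p hp => ?_
    have hae : (fun t => p.eval t) =ᵐ[G.edgeMeasure e] 0 :=
      (hmem p).coeFn_toLp.symm.trans ((Lp.eq_zero_iff_ae_eq_zero).1 hp)
    have hroots : EqOn (fun t => p.eval t) 0 (Icc 0 (G.len e)) :=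
      Measure.eqOn_Icc_of_ae_eq volume (G.len_pos e).ne hae p.continuous.continuousOn
        continuousOn_const
    exact p.eq_zero_of_infinite_isRoot ((Icc_infinite (G.len_pos e)).mono hroots)
  exact fun _ => Polynomial.not_finite (Module.Finite.of_injective toLp hinj)

end Edge

variable (G) in
/-- The point of the graph at an end of an edge. -/
def endPt (a : E × Bool) : G.Point := Quotient.mk G.glue (G.endPoint a)

theorem endPt_false (e : E) : G.endPt (e, false) = G.pt e 0 := by
  simp only [endPt, endPoint, pt, projIcc_left]
  rfl

theorem endPt_true (e : E) : G.endPt (e, true) = G.pt e (G.len e) := by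
  simp only [endPt, endPoint, pt, projIcc_right]
  rfl

theorem endPt_eq_of_mk_eq {a b : E × Bool}
    (h : Quotient.mk G.vertexSetoid a = Quotient.mk G.vertexSetoid b) : G.endPt a = G.endPt b :=
  Quotient.sound (Or.inr ⟨a, b, Quotient.exact h, rfl, rfl⟩)

namespace Sobolev

variable [Fintype E]

theorem exists_grad_eq_and_value_endPt_eq (c : G.Vertex → ℝ)
    (g : ∀ e, Lp ℝ 2 (G.edgeMeasure e))
    (hg : ∀ e, G.integralCLM e 0 (G.len e) (g e) =
      c (Quotient.mk _ (e, true)) - c (Quotient.mk _ (e, false))) :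
    ∃ v : G.Sobolev, (∀ e, grad e v = g e) ∧ ∀ a, value v (G.endPt a) = c (Quotient.mk _ a) := by
  have hzero (e : E) : G.integralCLM e 0 0 (g e) = 0 := by
    rw [integralCLM_apply le_rfl le_rfl (G.len_pos e).le, intervalIntegral.integral_same]
  let f (x : G.PrePoint) : ℝ := c (Quotient.mk _ (x.1, false)) + G.integralCLM x.1 0 x.2 (g x.1)
  have hend : ∀ a, f (G.endPoint a) = c (Quotient.mk _ a) := by
    rintro ⟨e, _ | _⟩
    · simp [f, endPoint, hzero]
    · simp [f, endPoint, hg]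
  have hglue : ∀ x y : G.PrePoint, G.glue x y → f x = f y := by
    rintro x y (rfl | ⟨a, b, h, rfl, rfl⟩)
    · rfl
    · rw [hend, hend, Quotient.sound h]
  have hcont : Continuous f := continuous_sigma fun e => by
    have hint := (Lp.memLp (g e)).integrable one_le_two
    have hprim := (continuousOn_primitive_of_integrable_edgeMeasure hint).comp_continuous
      continuous_subtype_val Subtype.prop
    refine Continuous.congr (f := fun t : Icc 0 (G.len e) =>
      c (Quotient.mk _ (e, false)) + ∫ s in (0 : ℝ)..t, g e s) (continuous_const.add hprim)
      fun t => ?_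
    exact congrArg _ (integralCLM_apply le_rfl t.2.1 t.2.2 _).symm
  refine ⟨⟨(⟨Quotient.lift f hglue, hcont.quotient_lift hglue⟩, g), fun e t ht => ?_⟩,
    fun _ => rfl, hend⟩
  change f ⟨e, projIcc 0 (G.len e) _ t⟩ = f ⟨e, projIcc 0 (G.len e) _ 0⟩ + _
  simp [f, projIcc_of_mem _ ht, projIcc_left, hzero]

variable (G) in
theorem not_finite [Nonempty E] : ¬ Module.Finite ℝ G.Sobolev := by
  classical
  intro hfin
  let e : E := Classical.arbitrary E
  have hker : (G.integralCLM e 0 (G.len e)).ker ≤ (grad e : G.Sobolev →L[ℝ] _).range := by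
    intro f hf
    obtain ⟨v, hv, -⟩ := exists_grad_eq_and_value_endPt_eq (fun _ : G.Vertex => 0)
      (Pi.single e f) fun e' => by
        obtain rfl | hne := eq_or_ne e' e
        · simpa using hf
        · simp [hne]
    exact ⟨v, by simp [hv]⟩
  have hrange : (grad e : G.Sobolev →L[ℝ] _).range.FG := Module.Finite.iff_fg.1 inferInstance
  refine not_finite_Lp_edgeMeasure (e := e) ⟨Submodule.fg_of_fg_map_of_fg_inf_ker
    (G.integralCLM e 0 (G.len e)).toLinearMap (IsNoetherian.noetherian _) ?_⟩
  rw [top_inf_eq]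
  exact Submodule.FG.of_le hrange hker

theorem exists_of_isH2 {u : G.Point → ℝ} {u' u'' : E → ℝ → ℝ} (h : G.IsH2 u u' u'') :
    ∃ w : G.Sobolev, ⇑(value w) = u ∧ ∀ e, grad e w =ᵐ[G.edgeMeasure e] u' e := by
  have hcont (e : E) : ContinuousOn (u' e) (Icc 0 (G.len e)) :=
    (continuousOn_const.add (continuousOn_primitive_of_integrable_edgeMeasure
      ((h.memLp e).integrable one_le_two))).congr (h.deriv_eq e)
  have hmem (e : E) : MemLp (u' e) 2 (G.edgeMeasure e) :=
    memLp_edgeMeasure_of_continuousOn (hcont e)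
  refine ⟨⟨(⟨u, h.continuous⟩, fun e => (hmem e).toLp), fun e t ht => ?_⟩, rfl,
    fun e => (hmem e).coeFn_toLp⟩
  change u (G.pt e t) = u (G.pt e 0) + G.integralCLM e 0 t (hmem e).toLp
  rw [integralCLM_eq_of_ae_eq (hmem e).coeFn_toLp le_rfl ht.1 ht.2,
    intervalIntegral.integral_eq_sub_of_hasDeriv_right_of_le (f := fun s => u (G.pt e s)) ht.1
      (h.continuous.comp (G.continuous_pt e)).continuousOn, add_sub_cancel]
  · intro s hs
    have hsI : s ∈ Ioo 0 (G.len e) := ⟨hs.1, hs.2.trans_le ht.2⟩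
    exact ((h.hasDeriv e s (Ioo_subset_Icc_self hsI)).hasDerivAt
      (Icc_mem_nhds hsI.1 hsI.2)).hasDerivWithinAt
  · exact intervalIntegrable_of_integrable_edgeMeasure ((hmem e).integrable one_le_two)
      (left_mem_Icc.2 (G.len_pos e).le) ht

theorem hasDerivWithinAt_value {w : G.Sobolev} {e : E} {p : ℝ → ℝ}
    (hp : ContinuousOn p (Icc 0 (G.len e))) (hw : grad e w =ᵐ[G.edgeMeasure e] p) {t : ℝ}
    (ht : t ∈ Icc 0 (G.len e)) :
    HasDerivWithinAt (fun s => value w (G.pt e s)) (p t) (Icc 0 (G.len e)) t := by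
  let p_ext := IccExtend (G.len_pos e).le ((Icc 0 (G.len e)).domRestrict p)
  have hp_ext : Continuous p_ext := hp.domRestrict.Icc_extend'
  have hp_eq : ∀ s ∈ Icc 0 (G.len e), p_ext s = p s := fun s hs => IccExtend_of_mem _ _ hs
  have hderiv : HasDerivAt (fun s => value w (G.pt e 0) + ∫ x in (0 : ℝ)..s, p_ext x) (p t) t :=
    hp_eq t ht ▸ (hp_ext.integral_hasStrictDerivAt 0 t).hasDerivAt.const_add _
  refine hderiv.hasDerivWithinAt.congr_of_mem (fun s hs => ?_) ht
  rw [intervalIntegral.integral_congr fun x hx => hp_eq x ?_,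
    ← integralCLM_eq_of_ae_eq hw le_rfl hs.1 hs.2,
    ← value_pt_sub_value_pt w le_rfl hs.1 hs.2, add_sub_cancel]
  rw [uIcc_of_le hs.1] at hx
  exact ⟨hx.1, hx.2.trans hs.2⟩

theorem sum_inner_grad_add_sum_integral {K : ∀ e, Lp ℝ 2 (G.edgeMeasure e)} {p p₁ : E → ℝ → ℝ}
    (hK : ∀ e, K e =ᵐ[G.edgeMeasure e] p e) (hp₁ : ∀ e, Integrable (p₁ e) (G.edgeMeasure e))
    (hp : ∀ e, ∀ t ∈ Icc 0 (G.len e), p e t = p e 0 + ∫ s in (0 : ℝ)..t, p₁ e s)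
    (v : G.Sobolev) :
    ∑ e, inner ℝ (K e) (grad e v) + ∑ e, ∫ t, p₁ e t * value v (G.pt e t) ∂(G.edgeMeasure e) =
      ∑ a : E × Bool, G.normalDeriv p a * value v (G.endPt a) := by
  rw [Fintype.sum_prod_type, ← Finset.sum_add_distrib]
  refine Finset.sum_congr rfl fun e _ => ?_
  have hl := (G.len_pos e).le
  have hI : uIcc 0 (G.len e) = Icc 0 (G.len e) := uIcc_of_le hl
  have hgrad := intervalIntegrable_of_Lp le_rfl hl le_rfl (grad e v)
  have hp₁e := intervalIntegrable_of_integrable_edgeMeasure (hp₁ e) (left_mem_Icc.2 hl)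
    (right_mem_Icc.2 hl)
  have hpcont : ContinuousOn (p e) (uIcc 0 (G.len e)) :=
    hI ▸ (continuousOn_const.add
      (continuousOn_primitive_of_integrable_edgeMeasure (hp₁ e))).congr (hp e)
  have hvcont : Continuous fun t => value v (G.pt e t) :=
    (value v).continuous.comp (G.continuous_pt e)
  have hinner : inner ℝ (K e) (grad e v) = ∫ t in (0 : ℝ)..G.len e, p e t * grad e v t := by
    rw [L2.inner_def, ← integral_edgeMeasure]
    refine integral_congr_ae ?_
    filter_upwards [hK e] with t ht
    rw [ht]
    exact mul_comm _ _
  rw [hinner, integral_edgeMeasure, ← intervalIntegral.integral_add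
    (hgrad.continuousOn_mul hpcont) (hp₁e.mul_continuousOn hvcont.continuousOn),
    integral_mul_add_mul_of_primitives hl hp₁e hgrad (hp e) fun t ht => value_pt v ht]
  simp only [Fintype.sum_bool, normalDeriv, endPt_true, endPt_false, if_true, Bool.false_eq_true,
    if_false]
  ring

theorem sum_normalDeriv_mul_value_eq_zero_iff {p : E → ℝ → ℝ} :
    (∀ v : G.Sobolev, ∑ a : E × Bool, G.normalDeriv p a * value v (G.endPt a) = 0) ↔
      G.Kirchhoff p := by
  classical
  refine ⟨fun h x => ?_, fun h v => ?_⟩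
  · let c : G.Vertex → ℝ := Pi.single x 1
    obtain ⟨v, -, hv⟩ := exists_grad_eq_and_value_endPt_eq c (fun e => Lp.const 2 _
      ((c (Quotient.mk _ (e, true)) - c (Quotient.mk _ (e, false))) / G.len e)) fun e => by
        rw [integralCLM_const, mul_div_cancel₀ _ (G.len_pos e).ne']
    have hsum := h v
    simp only [hv, c, Pi.single_apply, mul_ite, mul_one, mul_zero] at hsum
    rw [← Finset.sum_filter] at hsum
    convert hsum
  · have : Fintype G.Vertex := Fintype.ofFinite _
    rw [← Finset.sum_fiberwise (s := Finset.univ) (g := Quotient.mk G.vertexSetoid)]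
    refine Finset.sum_eq_zero fun x _ => ?_
    have hvalue : ∀ a ∈ Finset.univ.filter fun a => Quotient.mk G.vertexSetoid a = x,
        G.normalDeriv p a * value v (G.endPt a) =
          G.normalDeriv p a * value v (G.endPt x.out) := fun a ha => by
      rw [endPt_eq_of_mk_eq ((Finset.mem_filter.1 ha).2.trans x.out_eq.symm)]
    rw [Finset.sum_congr rfl hvalue, ← Finset.sum_mul]
    convert zero_mul _
    convert h x

/-- The du Bois-Reymond lemma, proved by testing with a primitive of `K` minus its mean. -/
theorem exists_ae_eq_const_of_sum_inner_grad_eq_zero {K : ∀ e, Lp ℝ 2 (G.edgeMeasure e)}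
    (hK : ∀ v : G.Sobolev, (∀ a, value v (G.endPt a) = 0) → ∑ e, inner ℝ (K e) (grad e v) = 0) :
    ∃ m : E → ℝ, ∀ e, K e =ᵐ[G.edgeMeasure e] fun _ => m e := by
  let m (e : E) : ℝ := G.integralCLM e 0 (G.len e) (K e) / G.len e
  let centred (e : E) : Lp ℝ 2 (G.edgeMeasure e) := K e - Lp.const 2 _ (m e)
  have hmean (e : E) : G.integralCLM e 0 (G.len e) (centred e) = 0 := by
    rw [map_sub, integralCLM_const, mul_div_cancel₀ _ (G.len_pos e).ne', sub_self]
  obtain ⟨v, hgrad, hv⟩ := exists_grad_eq_and_value_endPt_eq (fun _ : G.Vertex => 0) centred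
    (by simp [hmean])
  have hinner (e : E) : inner ℝ (K e) (grad e v) = inner ℝ (centred e) (centred e) := by
    have hK : K e = centred e + Lp.const 2 _ (m e) := (sub_add_cancel _ _).symm
    rw [hgrad, hK, inner_add_left, real_inner_comm _ (Lp.const 2 _ (m e)), inner_Lp_const, hmean,
      mul_zero, add_zero]
  have hsum := hK v hv
  simp only [hinner] at hsum
  rw [Finset.sum_eq_zero_iff_of_nonneg fun _ _ => real_inner_self_nonneg] at hsum
  refine ⟨m, fun e => ?_⟩
  have hcentred : centred e = 0 := inner_self_eq_zero.1 (hsum e (Finset.mem_univ e))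
  rw [sub_eq_zero.1 hcentred]
  exact Lp.coeFn_const ..

theorem exists_grad_ae_eq_primitive {w : G.Sobolev} {r : E → ℝ → ℝ}
    (hr : ∀ e, Integrable (r e) (G.edgeMeasure e))
    (hw : ∀ v : G.Sobolev, (∀ a, value v (G.endPt a) = 0) →
      dirichlet w v + ∑ e, ∫ t, r e t * value v (G.pt e t) ∂(G.edgeMeasure e) = 0) :
    ∃ m : E → ℝ, ∀ e, grad e w =ᵐ[G.edgeMeasure e] fun t => m e + ∫ s in (0 : ℝ)..t, r e s := by
  have hmem (e : E) : MemLp (fun t => ∫ s in (0 : ℝ)..t, r e s) 2 (G.edgeMeasure e) :=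
    memLp_edgeMeasure_of_continuousOn (continuousOn_primitive_of_integrable_edgeMeasure (hr e))
  obtain ⟨m, hm⟩ := exists_ae_eq_const_of_sum_inner_grad_eq_zero
    (K := fun e => grad e w - (hmem e).toLp) fun v hv => by
      have hgreen := sum_inner_grad_add_sum_integral (fun e => (hmem e).coeFn_toLp) hr
        (fun e t _ => by rw [intervalIntegral.integral_same, zero_add]) v
      simp only [hv, mul_zero, Finset.sum_const_zero] at hgreen
      have hweak := hw v hv
      rw [dirichlet_apply] at hweak
      simp only [inner_sub_left, Finset.sum_sub_distrib]
      linarith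
  refine ⟨m, fun e => ?_⟩
  filter_upwards [hm e, Lp.coeFn_sub (grad e w) (hmem e).toLp, (hmem e).coeFn_toLp]
    with t hmt hsub hprim
  rw [hsub, Pi.sub_apply, hprim] at hmt
  linarith

variable {q : G.Point → ℝ}

/-- `w` is a weak solution of `-w'' + q w = κ w` with Kirchhoff conditions. -/
def IsWeakSolution (hq : IsBoundedPotential q) (κ : ℝ) (w : G.Sobolev) : Prop :=
  ∀ v, schrodinger hq w v = κ * mass w v

theorem weight_sub_mul_mass (hq : IsBoundedPotential q) (κ : ℝ) (w v : G.Sobolev) :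
    weight hq w v - κ * mass w v = ∑ e, ∫ t, (q (G.pt e t) - κ) * value w (G.pt e t) *
      value v (G.pt e t) ∂(G.edgeMeasure e) := by
  rw [weight_apply, mass_apply, Finset.mul_sum, ← Finset.sum_sub_distrib]
  refine Finset.sum_congr rfl fun e _ => ?_
  have hqwv : Integrable (fun t => q (G.pt e t) * (value w (G.pt e t) * value v (G.pt e t)))
      (G.edgeMeasure e) := hq.integrable_mul_continuous e (value w * value v)
  have hwv : Integrable (fun t => κ * (value w (G.pt e t) * value v (G.pt e t)))
      (G.edgeMeasure e) :=
    (IsBoundedPotential.const κ).integrable_mul_continuous e (value w * value v)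
  rw [← integral_const_mul, ← integral_sub hqwv hwv]
  exact integral_congr_ae (.of_forall fun t => by ring)

theorem exists_isWeakSolution (hq : IsBoundedPotential q) {κ : ℝ} {u : G.Point → ℝ}
    (h : G.IsEigenfunction q κ u) : ∃ w : G.Sobolev, ⇑(value w) = u ∧ IsWeakSolution hq κ w := by
  obtain ⟨-, u', u'', hH2, hK, heq⟩ := h
  obtain ⟨w, rfl, hw⟩ := exists_of_isH2 hH2
  refine ⟨w, rfl, fun v => ?_⟩
  have hgreen := sum_inner_grad_add_sum_integral hw
    (fun e => (hH2.memLp e).integrable one_le_two) hH2.deriv_eq v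
  rw [sum_normalDeriv_mul_value_eq_zero_iff.2 hK v, ← dirichlet_apply] at hgreen
  have hrhs := weight_sub_mul_mass hq κ w v
  have hode : ∑ e, ∫ t, u'' e t * value v (G.pt e t) ∂(G.edgeMeasure e) =
      ∑ e, ∫ t, (q (G.pt e t) - κ) * value w (G.pt e t) * value v (G.pt e t)
        ∂(G.edgeMeasure e) := by
    refine Finset.sum_congr rfl fun e _ => integral_congr_ae ?_
    filter_upwards [heq e] with t ht
    rw [show u'' e t = (q (G.pt e t) - κ) * value w (G.pt e t) by linarith]
  rw [schrodinger_apply]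
  linarith

theorem IsWeakSolution.isEigenfunction {hq : IsBoundedPotential q} {κ : ℝ} {w : G.Sobolev}
    (hw : IsWeakSolution hq κ w) (hne : w ≠ 0) : G.IsEigenfunction q κ (value w) := by
  let r (e : E) (t : ℝ) : ℝ := (q (G.pt e t) - κ) * value w (G.pt e t)
  have hrmem (e : E) : MemLp (r e) 2 (G.edgeMeasure e) := by
    obtain ⟨C, hC⟩ := hq.bounded
    have hwmem : MemLp (fun t => value w (G.pt e t)) 2 (G.edgeMeasure e) :=
      memLp_edgeMeasure_of_continuousOn
        ((value w).continuous.comp (G.continuous_pt e)).continuousOn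
    refine hwmem.of_le_mul (c := C + |κ|) (((hq.aestronglyMeasurable e).sub
      aestronglyMeasurable_const).mul hwmem.1) (.of_forall fun t => ?_)
    rw [norm_mul]
    gcongr
    exact (abs_sub _ _).trans (by gcongr; exact hC _)
  have hr (e : E) : Integrable (r e) (G.edgeMeasure e) := (hrmem e).integrable one_le_two
  have hweak (v : G.Sobolev) :
      dirichlet w v + ∑ e, ∫ t, r e t * value v (G.pt e t) ∂(G.edgeMeasure e) = 0 := by
    have hwv := hw v
    rw [schrodinger_apply] at hwv
    rw [← weight_sub_mul_mass hq κ w v]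
    linarith
  obtain ⟨m, hm⟩ := exists_grad_ae_eq_primitive hr fun v _ => hweak v
  let p (e : E) (t : ℝ) : ℝ := m e + ∫ s in (0 : ℝ)..t, r e s
  have hp (e : E) : ∀ t ∈ Icc 0 (G.len e), p e t = p e 0 + ∫ s in (0 : ℝ)..t, r e s := by
    simp [p]
  refine ⟨fun h0 => hne (eq_zero_of_value_eq_zero (DFunLike.coe_injective h0)), p, r,
    ⟨(value w).continuous, fun e t ht => ?_, hrmem, hp⟩, ?_, fun e => .of_forall fun t => ?_⟩
  · exact hasDerivWithinAt_value
      (continuousOn_const.add (continuousOn_primitive_of_integrable_edgeMeasure (hr e))) (hm e) ht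
  · refine sum_normalDeriv_mul_value_eq_zero_iff.1 fun v => ?_
    rw [← sum_inner_grad_add_sum_integral hm hr hp v, ← dirichlet_apply, hweak v]
  · simp only [r]
    ring

end Sobolev

open Sobolev

variable [Fintype E] {q : G.Point → ℝ}

theorem isLeast_atLeastEigenvalues {hq : IsBoundedPotential q} {w : ℕ → G.Sobolev}
    (hw : IsRayleighSequence (schrodinger hq) mass w) (n : ℕ) :
    IsLeast (G.atLeastEigenvalues q (n + 1)) (schrodinger hq (w n) (w n)) := by
  have hell := isEllipticPair hq
  have hvalue : Function.Injective (value : G.Sobolev →L[ℝ] C(G.Point, ℝ)) :=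
    (injective_iff_map_eq_zero _).2 fun _ => eq_zero_of_value_eq_zero
  let coe : C(G.Point, ℝ) →ₗ[ℝ] G.Point → ℝ := ContinuousMap.coeFnLinearMap ℝ
  have hcoe : Function.Injective (coe ∘ₗ (value (G := G)).toLinearMap) :=
    DFunLike.coe_injective.comp hvalue
  constructor
  · have hli := hw.linearIndependent hell (n + 1)
    refine ⟨fun i => value (w i), hli.map' _ (LinearMap.ker_eq_bot.2 hcoe), fun i => ?_⟩
    exact ⟨_, hw.monotone (Nat.lt_succ_iff.1 i.2),
      IsWeakSolution.isEigenfunction (hw.apply_eq hell i) (hli.ne_zero i)⟩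
  · rintro x ⟨u, hu, heig⟩
    choose κ hκx hκ using heig
    choose v hv hweak using fun i => exists_isWeakSolution hq (hκ i)
    have hli : LinearIndependent ℝ v := by
      refine .of_comp (coe ∘ₗ (value (G := G)).toLinearMap) ?_
      have hcomp : (coe ∘ₗ (value (G := G)).toLinearMap) ∘ v = u := funext hv
      rwa [hcomp]
    obtain ⟨i, hi⟩ := hw.exists_le_of_linearIndependent hell hli hweak
    exact hi.trans (hκx i)

theorem eigenvalue_eq {hq : IsBoundedPotential q} {w : ℕ → G.Sobolev}
    (hw : IsRayleighSequence (schrodinger hq) mass w) (n : ℕ) :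
    G.eigenvalue q (n + 1) = schrodinger hq (w n) (w n) :=
  (isLeast_atLeastEigenvalues hw n).csInf_eq

theorem exists_isRayleighSequence [Nonempty E] (hq : IsBoundedPotential q) :
    ∃ w, IsRayleighSequence (schrodinger hq) mass w :=
  (isEllipticPair hq).exists_isRayleighSequence (not_finite G)

theorem isLeast_eigenvalue [Nonempty E] (hq : IsBoundedPotential q) (n : ℕ) :
    IsLeast (G.atLeastEigenvalues q (n + 1)) (G.eigenvalue q (n + 1)) := by
  obtain ⟨w, hw⟩ := exists_isRayleighSequence hq
  rw [eigenvalue_eq hw]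
  exact isLeast_atLeastEigenvalues hw n

end MetricGraph

/-! ### Weak convergence of potentials -/

namespace MetricGraph

variable {E : Type*} [Fintype E] {G : MetricGraph E}

/-- Convergence of potentials in the weak sense: the integrals against every fixed continuous
function on the graph converge. -/
def WeakTendsto (q : ℕ → G.Point → ℝ) (q₀ : G.Point → ℝ) : Prop :=
  ∀ f : C(G.Point, ℝ),
    Tendsto (fun n => ∑ e, ∫ t, q n (G.pt e t) * f (G.pt e t) ∂(G.edgeMeasure e)) atTop
      (𝓝 (∑ e, ∫ t, q₀ (G.pt e t) * f (G.pt e t) ∂(G.edgeMeasure e)))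

namespace WeakTendsto

variable {q : ℕ → G.Point → ℝ} {q₀ : G.Point → ℝ}

theorem comp (h : WeakTendsto q q₀) {φ : ℕ → ℕ} (hφ : Tendsto φ atTop atTop) :
    WeakTendsto (q ∘ φ) q₀ := fun f => (h f).comp hφ

open Sobolev

theorem tendsto_integral (h : WeakTendsto q q₀) (hq : ∀ n, IsBoundedPotential (q n))
    (hq₀ : IsBoundedPotential q₀) {C : ℝ} (hC : ∀ n x, |q n x| ≤ C) {f : ℕ → C(G.Point, ℝ)}
    {f₀ : C(G.Point, ℝ)} (hf : Tendsto f atTop (𝓝 f₀)) :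
    Tendsto (fun n => (hq n).integral (f n)) atTop (𝓝 (hq₀.integral f₀)) := by
  have hdiff : Tendsto (fun n => (hq n).integral (f n - f₀)) atTop (𝓝 0) := by
    refine squeeze_zero_norm (fun n => (hq n).abs_integral_le (hC n) _) ?_
    simpa using (tendsto_iff_norm_sub_tendsto_zero.1 hf).const_mul (C * ∑ e, G.len e)
  have hsum := hdiff.add (h f₀)
  simp only [← (hq _).integral_apply, ← hq₀.integral_apply, map_sub, sub_add_cancel,
    zero_add] at hsum
  exact hsum

theorem tendsto_weight_sub (h : WeakTendsto q q₀) (hq : ∀ n, IsBoundedPotential (q n))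
    (hq₀ : IsBoundedPotential q₀) {C : ℝ} (hC : ∀ n x, |q n x| ≤ C) {v : ℕ → G.Sobolev} {R : ℝ}
    (hv : ∀ n, ‖v n‖ ≤ R) :
    Tendsto (fun n => weight (hq n) (v n) (v n) - weight hq₀ (v n) (v n)) atTop (𝓝 0) := by
  refine tendsto_of_subseq_tendsto fun ns hns => ?_
  obtain ⟨φ, u, hφ, hu⟩ := exists_subseq_tendsto_value fun n => hv (ns n)
  have hsq := hu.mul hu
  refine ⟨φ, ?_⟩
  simpa only [weight_eq_integral, sub_self, Function.comp_def] using
    ((h.comp (hns.comp hφ.tendsto_atTop)).tendsto_integral (fun n => hq (ns (φ n))) hq₀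
      (fun n => hC (ns (φ n))) hsq).sub ((hq₀.integral.continuous.tendsto _).comp hsq)

/-- On the unit ball of `H¹` the forms converge uniformly, because the ball is compact in `C`. -/
theorem eventually_abs_weight_sub_le (h : WeakTendsto q q₀) (hq : ∀ n, IsBoundedPotential (q n))
    (hq₀ : IsBoundedPotential q₀) {C : ℝ} (hC : ∀ n x, |q n x| ≤ C) {ε : ℝ} (hε : 0 < ε) :
    ∀ᶠ n in atTop, ∀ v, |weight (hq n) v v - weight hq₀ v v| ≤ ε * ‖v‖ ^ 2 := by
  have hunit : ∀ n, ∃ v : G.Sobolev, ‖v‖ ≤ 1 ∧ (|weight (hq n) v v - weight hq₀ v v| ≤ ε →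
      ∀ u, |weight (hq n) u u - weight hq₀ u u| ≤ ε * ‖u‖ ^ 2) := by
    intro n
    by_cases! hall : ∀ u, |weight (hq n) u u - weight hq₀ u u| ≤ ε * ‖u‖ ^ 2
    · exact ⟨0, by simp, fun _ => hall⟩
    obtain ⟨u, hu⟩ := hall
    have hu₀ : 0 < ‖u‖ := norm_pos_iff.2 fun h₀ => by simp [h₀] at hu
    refine ⟨‖u‖⁻¹ • u, by simp [norm_smul, hu₀.ne'], fun hle => absurd hle (not_le.2 ?_)⟩
    simp only [map_smul, smul_apply, smul_eq_mul, ← mul_sub, abs_mul,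
      abs_inv, abs_norm]
    rw [← div_eq_inv_mul, ← div_eq_inv_mul, div_div, lt_div_iff₀ (by positivity), ← sq]
    exact hu
  choose v hv hbound using hunit
  filter_upwards [(h.tendsto_weight_sub hq hq₀ hC hv).eventually (Metric.ball_mem_nhds 0 hε)]
    with n hn
  exact hbound n (by simpa using (mem_ball_zero_iff.1 hn).le)

theorem eventually_schrodinger_le (h : WeakTendsto q q₀) (hq : ∀ n, IsBoundedPotential (q n))
    (hq₀ : IsBoundedPotential q₀) {C : ℝ} (hC : ∀ n x, |q n x| ≤ C) (hC₀ : ∀ x, |q₀ x| ≤ C)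
    {ε : ℝ} (hε : 0 < ε) :
    ∀ᶠ n in atTop, ∀ v,
      schrodinger (hq n) v v ≤ (1 + ε) * schrodinger hq₀ v v + ε * (C + 1) * mass v v ∧
      schrodinger hq₀ v v ≤ (1 + ε) * schrodinger (hq n) v v + ε * (C + 1) * mass v v := by
  obtain ⟨B, hB, hnorm⟩ := exists_norm_sq_le G
  filter_upwards [h.eventually_abs_weight_sub_le hq hq₀ hC (div_pos hε hB)] with n hn v
  have hdiff : |weight (hq n) v v - weight hq₀ v v| ≤ ε * (dirichlet v v + mass v v) :=
    calc |weight (hq n) v v - weight hq₀ v v| ≤ ε / B * ‖v‖ ^ 2 := hn v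
      _ ≤ ε / B * (B * (dirichlet v v + mass v v)) := by gcongr; exact hnorm v
      _ = ε * (dirichlet v v + mass v v) := by field_simp
  have hdir : ∀ {ρ : G.Point → ℝ} (hρ : IsBoundedPotential ρ), (∀ x, |ρ x| ≤ C) →
      ε * dirichlet v v ≤ ε * (schrodinger hρ v v + C * mass v v) := fun hρ hρC => by
    have hw := abs_le.1 (abs_weight_self_le hρ hρC v)
    rw [schrodinger_apply]
    gcongr
    linarith
  have hn := hdir (hq n) (hC n)
  have h₀ := hdir hq₀ hC₀
  obtain ⟨hlo, hup⟩ := abs_le.1 hdiff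
  simp only [schrodinger_apply] at hn h₀ ⊢
  constructor <;> linarith

variable [Nonempty E]

theorem tendsto_eigenvalue (h : WeakTendsto q q₀) (hq : ∀ n, IsBoundedPotential (q n))
    (hq₀ : IsBoundedPotential q₀) {C : ℝ} (hC : ∀ n x, |q n x| ≤ C) (hC₀ : ∀ x, |q₀ x| ≤ C)
    (m : ℕ) :
    Tendsto (fun n => G.eigenvalue (q n) (m + 1)) atTop (𝓝 (G.eigenvalue q₀ (m + 1))) := by
  choose w hw using fun n => exists_isRayleighSequence (hq n)
  obtain ⟨w₀, hw₀⟩ := exists_isRayleighSequence hq₀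
  set L := G.eigenvalue q₀ (m + 1) with hL
  have hbounds : ∀ {ε : ℝ}, 0 < ε → ∀ᶠ n in atTop,
      G.eigenvalue (q n) (m + 1) ≤ (1 + ε) * L + ε * (C + 1) ∧
      L ≤ (1 + ε) * G.eigenvalue (q n) (m + 1) + ε * (C + 1) := by
    intro ε hε
    have hs : 0 ≤ 1 + ε := by positivity
    filter_upwards [h.eventually_schrodinger_le hq hq₀ hC hC₀ hε] with n hn
    rw [hL, eigenvalue_eq (hw n), eigenvalue_eq hw₀]
    exact ⟨hw₀.apply_self_le_mul_add (isEllipticPair hq₀) (hw n) hs (fun v => (hn v).1) m,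
      (hw n).apply_self_le_mul_add (isEllipticPair (hq n)) hw₀ hs (fun v => (hn v).2) m⟩
  have hupper : ContinuousAt (fun ε => (1 + ε) * L + ε * (C + 1)) 0 := by fun_prop
  have hlower : ContinuousAt (fun ε => (L - ε * (C + 1)) / (1 + ε)) 0 := by
    fun_prop (disch := norm_num)
  simp only [ContinuousAt, add_zero, one_mul, zero_mul, sub_zero, div_one] at hupper hlower
  refine tendsto_order.2 ⟨fun a ha => ?_, fun a ha => ?_⟩
  · obtain ⟨ε, hlt, hε⟩ := (((hlower.mono_left nhdsWithin_le_nhds).eventually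
      (lt_mem_nhds ha)).and self_mem_nhdsWithin : ∀ᶠ ε in 𝓝[>] (0 : ℝ), _).exists
    filter_upwards [hbounds hε] with n hn
    refine hlt.trans_le ((div_le_iff₀ (add_pos one_pos hε)).2 ?_)
    linarith
  · obtain ⟨ε, hlt, hε⟩ := (((hupper.mono_left nhdsWithin_le_nhds).eventually
      (gt_mem_nhds ha)).and self_mem_nhdsWithin : ∀ᶠ ε in 𝓝[>] (0 : ℝ), _).exists
    filter_upwards [hbounds hε] with n hn
    exact hn.1.trans_lt hlt

theorem tendsto_gap (h : WeakTendsto q q₀) (hq : ∀ n, IsBoundedPotential (q n))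
    (hq₀ : IsBoundedPotential q₀) {C : ℝ} (hC : ∀ n x, |q n x| ≤ C) (hC₀ : ∀ x, |q₀ x| ≤ C) :
    Tendsto (fun n => G.gap (q n)) atTop (𝓝 (G.gap q₀)) :=
  (h.tendsto_eigenvalue hq hq₀ hC hC₀ 1).sub (h.tendsto_eigenvalue hq hq₀ hC hC₀ 0)

end WeakTendsto

end MetricGraph

/-! ### Selection theorems -/

namespace MetricGraph

theorem exists_subseq_forall_tendsto_of_countable {X : Type*} {D : Set X} (hD : D.Countable)
    {f : ℕ → X → ℝ} {C : ℝ} (hf : ∀ n, ∀ x ∈ D, |f n x| ≤ C) :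
    ∃ φ : ℕ → ℕ, StrictMono φ ∧ ∀ x ∈ D, ∃ y, Tendsto (fun n => f (φ n) x) atTop (𝓝 y) := by
  have := hD.to_subtype
  obtain ⟨y, -, φ, hφ, hy⟩ := (isCompact_univ_pi fun _ : D => isCompact_Icc (a := -C)
    (b := C)).tendsto_subseq (x := fun n (x : D) => f n x) fun n x _ => abs_le.1 (hf n x x.2)
  exact ⟨φ, hφ, fun x hx => ⟨y ⟨x, hx⟩, tendsto_pi_nhds.1 hy ⟨x, hx⟩⟩⟩

theorem cauchySeq_of_forall_eventually_dist_le {X : Type*} [PseudoMetricSpace X] {u : ℕ → X}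
    (h : ∀ ε > 0, ∃ v, CauchySeq v ∧ ∀ᶠ n in atTop, dist (u n) (v n) ≤ ε) : CauchySeq u := by
  refine Metric.cauchySeq_iff'.2 fun ε hε => ?_
  obtain ⟨v, hv, huv⟩ := h (ε / 4) (by positivity)
  obtain ⟨N, hN⟩ := eventually_atTop.1 huv
  obtain ⟨N', hN'⟩ := Metric.cauchySeq_iff.1 hv (ε / 4) (by positivity)
  refine ⟨max N N', fun n hn => ?_⟩
  calc dist (u n) (u (max N N'))
      ≤ dist (u n) (v n) + dist (v n) (v (max N N')) + dist (v (max N N')) (u (max N N')) :=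
        dist_triangle4 ..
    _ < ε := by
      have hun := hN n (le_of_max_le_left hn)
      have huN := dist_comm (u _) (v _) ▸ hN (max N N') (le_max_left ..)
      have hvv := hN' n (le_of_max_le_right hn) (max N N') (le_max_right ..)
      linarith

section Helly

variable {f : ℕ → ℝ → ℝ} {a b M : ℝ} {D : Set ℝ}

/-- Helly's selection principle, by continuity of the upper limit: at a point of continuity, the
upper limit is the supremum of the limits at the points of `D` to the left. -/
theorem countable_not_tendsto_of_monotoneOn (hD : Dense D) (hM : ∀ n t, |f n t| ≤ M)
    (hlim : ∀ r ∈ D, ∃ y, Tendsto (fun n => f n r) atTop (𝓝 y))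
    (hmono : ∀ᶠ n in atTop, MonotoneOn (f n) (Ioo a b)) :
    {t ∈ Ioo a b | ¬ ∃ y, Tendsto (fun n => f n t) atTop (𝓝 y)}.Countable := by
  have hup (t : ℝ) : IsBoundedUnder (· ≤ ·) atTop fun n => f n t :=
    isBoundedUnder_of ⟨M, fun n => (abs_le.1 (hM n t)).2⟩
  have hlow (t : ℝ) : IsBoundedUnder (· ≥ ·) atTop fun n => f n t :=
    isBoundedUnder_of ⟨-M, fun n => (abs_le.1 (hM n t)).1⟩
  let F (t : ℝ) : ℝ := limsup (fun n => f n t) atTop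
  have hF : MonotoneOn F (Ioo a b) := fun s hs t ht hst =>
    limsup_le_limsup (hmono.mono fun n hn => hn hs ht hst) (hlow s).isCoboundedUnder_le (hup t)
  refine hF.countable_not_continuousWithinAt.mono ?_
  rintro t ⟨ht, hbad⟩
  refine ⟨ht, fun hcont => hbad ⟨F t, ?_⟩⟩
  refine tendsto_of_le_liminf_of_limsup_le (le_of_forall_lt fun c hc => ?_) le_rfl (hup t) (hlow t)
  obtain ⟨l, hlt, hl⟩ := exists_Ioc_subset_of_mem_nhds
    ((hcont.continuousAt (Ioo_mem_nhds ht.1 ht.2)).eventually (lt_mem_nhds hc)) ⟨a, ht.1⟩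
  obtain ⟨r, hrD, hlr, hrt⟩ := hD.exists_between (max_lt hlt ht.1)
  obtain ⟨y, hy⟩ := hlim r hrD
  have hra : r ∈ Ioo a b := ⟨(le_max_right ..).trans_lt hlr, hrt.trans ht.2⟩
  calc c < F r := hl ⟨(le_max_left ..).trans_lt hlr, hrt.le⟩
    _ = liminf (fun n => f n r) atTop := hy.limsup_eq.trans hy.liminf_eq.symm
    _ ≤ liminf (fun n => f n t) atTop :=
      liminf_le_liminf (hmono.mono fun n hn => hn hra ht hrt.le) (hlow r)
        (hup t).isCoboundedUnder_ge

theorem countable_not_tendsto_of_antitoneOn (hD : Dense D) (hM : ∀ n t, |f n t| ≤ M)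
    (hlim : ∀ r ∈ D, ∃ y, Tendsto (fun n => f n r) atTop (𝓝 y))
    (hanti : ∀ᶠ n in atTop, AntitoneOn (f n) (Ioo a b)) :
    {t ∈ Ioo a b | ¬ ∃ y, Tendsto (fun n => f n t) atTop (𝓝 y)}.Countable := by
  refine (countable_not_tendsto_of_monotoneOn (f := fun n t => -f n t) hD (by simpa using hM)
    (fun r hr => (hlim r hr).imp' Neg.neg fun y hy => hy.neg)
    (hanti.mono fun n hn => hn.neg)).mono ?_
  rintro t ⟨ht, hbad⟩
  exact ⟨ht, fun ⟨y, hy⟩ => hbad ⟨-y, by simpa using hy.neg⟩⟩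

/-- Bounded convex functions are locally equi-Lipschitz. -/
theorem exists_tendsto_of_convexOn (hD : Dense D) (hM : ∀ n t, |f n t| ≤ M)
    (hlim : ∀ r ∈ D, ∃ y, Tendsto (fun n => f n r) atTop (𝓝 y))
    (hconv : ∀ᶠ n in atTop, ConvexOn ℝ (Ioo a b) (f n)) {t : ℝ} (ht : t ∈ Ioo a b) :
    ∃ y, Tendsto (fun n => f n t) atTop (𝓝 y) := by
  obtain ⟨ρ, hρ, hball⟩ := Metric.isOpen_iff.1 isOpen_Ioo t ht
  refine cauchySeq_tendsto_of_complete (cauchySeq_of_forall_eventually_dist_le fun ε hε => ?_)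
  set L := (2 * M / (ρ / 2)).toNNReal
  have hcont : Continuous fun s : ℝ => L * dist t s := by fun_prop
  obtain ⟨r, hrD, hr⟩ := hD.exists_mem_open
    ((isOpen_Iio (a := ε)).preimage hcont |>.inter (Metric.isOpen_ball (x := t) (ε := ρ / 2)))
    ⟨t, by simpa using hε, Metric.mem_ball_self (by positivity)⟩
  obtain ⟨y, hy⟩ := hlim r hrD
  refine ⟨_, hy.cauchySeq, hconv.mono fun n hn => ?_⟩
  have hlip := (hn.subset hball (convex_ball t ρ)).lipschitzOnWith_of_abs_le (half_pos hρ)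
    fun s _ => hM n s
  rw [sub_half] at hlip
  exact (hlip.dist_le_mul t (Metric.mem_ball_self (by positivity)) r hr.2).trans hr.1.le

/-- The functions `f n` are eventually all monotone, all antitone or all convex on `(a, b)`. -/
def EventuallyRegular (f : ℕ → ℝ → ℝ) (a b : ℝ) : Prop :=
  (∀ᶠ n in atTop, MonotoneOn (f n) (Ioo a b)) ∨ (∀ᶠ n in atTop, AntitoneOn (f n) (Ioo a b)) ∨
    ∀ᶠ n in atTop, ConvexOn ℝ (Ioo a b) (f n)

theorem EventuallyRegular.comp (h : EventuallyRegular f a b) {φ : ℕ → ℕ}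
    (hφ : Tendsto φ atTop atTop) : EventuallyRegular (fun n => f (φ n)) a b :=
  h.imp hφ.eventually (Or.imp hφ.eventually hφ.eventually)

theorem EventuallyRegular.countable_not_tendsto (h : EventuallyRegular f a b) (hD : Dense D)
    (hM : ∀ n t, |f n t| ≤ M) (hlim : ∀ r ∈ D, ∃ y, Tendsto (fun n => f n r) atTop (𝓝 y)) :
    {t ∈ Ioo a b | ¬ ∃ y, Tendsto (fun n => f n t) atTop (𝓝 y)}.Countable := by
  rcases h with h | h | h
  · exact countable_not_tendsto_of_monotoneOn hD hM hlim h
  · exact countable_not_tendsto_of_antitoneOn hD hM hlim h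
  · convert countable_empty
    exact eq_empty_of_forall_notMem fun t ⟨ht, hbad⟩ =>
      hbad (exists_tendsto_of_convexOn hD hM hlim h ht)

end Helly

section WeakLimit

theorem exists_subseq_tendsto_inner {H : Type*} [NormedAddCommGroup H] [InnerProductSpace ℝ H]
    [CompleteSpace H] [TopologicalSpace.SeparableSpace H] {x : ℕ → H} {R : ℝ}
    (hx : ∀ n, ‖x n‖ ≤ R) :
    ∃ (φ : ℕ → ℕ) (w : H), StrictMono φ ∧
      ∀ v, Tendsto (fun n => inner ℝ (x (φ n)) v) atTop (𝓝 (inner ℝ w v)) := by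
  obtain ⟨L, -, φ, hφ, hL⟩ := WeakDual.isSeqCompact_closedBall ℝ H 0 R
    (x := fun n => StrongDual.toWeakDual (innerSL ℝ (x n))) fun n => by simpa using hx n
  refine ⟨φ, (InnerProductSpace.toDual ℝ H).symm (WeakDual.toStrongDual L), hφ, fun v => ?_⟩
  rw [InnerProductSpace.toDual_symm_apply]
  exact ((WeakDual.eval_continuous v).tendsto L).comp hL

variable {α : Type*} [MeasurableSpace α]

theorem integral_mul_indicator_one {ν : Measure α} {s : Set α} (hs : MeasurableSet s)
    (f : α → ℝ) : ∫ x, f x * s.indicator 1 x ∂ν = ∫ x in s, f x ∂ν := by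
  simp only [← integral_indicator hs, ← indicator_mul_right, Pi.one_apply, mul_one]

theorem exists_subseq_tendsto_integral_mul [MeasurableSpace.CountablyGenerated α] {ι : Type*}
    [Finite ι] {ν : ι → Measure α} [∀ i, IsFiniteMeasure (ν i)] {f : ℕ → ι → α → ℝ} {M : ℝ}
    (hf : ∀ n i, AEStronglyMeasurable (f n i) (ν i)) (hM : ∀ n i x, |f n i x| ≤ M) :
    ∃ (φ : ℕ → ℕ) (w : ι → α → ℝ), StrictMono φ ∧ (∀ i, MemLp (w i) 2 (ν i)) ∧
      ∀ i g, MemLp g 2 (ν i) →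
        Tendsto (fun n => ∫ x, f (φ n) i x * g x ∂(ν i)) atTop (𝓝 (∫ x, w i x * g x ∂(ν i))) := by
  classical
  have := Fintype.ofFinite ι
  have : Fact ((2 : ENNReal) ≠ ⊤) := ⟨by simp⟩
  have hLp n i : MemLp (f n i) 2 (ν i) := .of_bound (hf n i) M (.of_forall (hM n i))
  have hinner : ∀ {i} {g h : α → ℝ} (hg : MemLp g 2 (ν i)) (hh : MemLp h 2 (ν i)),
      inner ℝ (hg.toLp g) (hh.toLp h) = ∫ x, g x * h x ∂(ν i) := fun hg hh => by
    rw [L2.inner_def]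
    refine integral_congr_ae ?_
    filter_upwards [hg.coeFn_toLp, hh.coeFn_toLp] with x hgx hhx
    rw [hgx, hhx, real_inner_comm, RCLike.inner_apply, conj_trivial]
  let x (n : ℕ) : PiLp 2 fun i => Lp ℝ 2 (ν i) := WithLp.toLp 2 fun i => (hLp n i).toLp (f n i)
  have hx n : ‖x n‖ ≤ √(∑ i, M * M * (ν i).real univ) := by
    refine Real.le_sqrt_of_sq_le ?_
    rw [PiLp.norm_sq_eq_of_L2]
    refine Finset.sum_le_sum fun i _ => ?_
    rw [← real_inner_self_eq_norm_sq, hinner]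
    refine (Real.le_norm_self _).trans
      (norm_integral_le_of_norm_le_const (.of_forall fun t => ?_))
    rw [norm_mul]
    exact mul_self_le_mul_self (norm_nonneg _) (hM n i t)
  have hsingle : ∀ (u : PiLp 2 fun i => Lp ℝ 2 (ν i)) i v,
      inner ℝ u (PiLp.single 2 i v) = inner ℝ (u i) v := fun u i v => by
    rw [PiLp.inner_apply, Finset.sum_eq_single i (by simp +contextual) (by simp),
      PiLp.single_eq_same]
  obtain ⟨φ, w, hφ, hw⟩ := exists_subseq_tendsto_inner hx
  refine ⟨φ, fun i => w i, hφ, fun i => Lp.memLp _, fun i g hg => ?_⟩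
  simpa only [x, hsingle, hinner, ← hinner (Lp.memLp (w i)) hg, Lp.toLp_coeFn] using
    hw (PiLp.single 2 i (hg.toLp g))

theorem ae_mem_Icc_of_tendsto_setIntegral {ν : Measure α} [IsFiniteMeasure ν] {f : ℕ → α → ℝ}
    {w : α → ℝ} {a b : ℝ} (hf : ∀ n, AEStronglyMeasurable (f n) ν) (hfab : ∀ n x, f n x ∈ Icc a b)
    (hw : Integrable w ν)
    (h : ∀ s, MeasurableSet s →
      Tendsto (fun n => ∫ x in s, f n x ∂ν) atTop (𝓝 (∫ x in s, w x ∂ν))) :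
    ∀ᵐ x ∂ν, w x ∈ Icc a b := by
  have hint n : Integrable (f n) ν := .of_mem_Icc a b (hf n).aemeasurable (.of_forall (hfab n))
  have hlow : (fun _ => a) ≤ᵐ[ν] w :=
    ae_le_of_forall_setIntegral_le (integrable_const a) hw fun s hs _ =>
      ge_of_tendsto (h s hs) (.of_forall fun n =>
        integral_mono (integrable_const a) (hint n).integrableOn fun x => (hfab n x).1)
  have hup : w ≤ᵐ[ν] fun _ => b :=
    ae_le_of_forall_setIntegral_le hw (integrable_const b) fun s hs _ =>
      le_of_tendsto (h s hs) (.of_forall fun n =>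
        integral_mono (hint n).integrableOn (integrable_const b) fun x => (hfab n x).2)
  filter_upwards [hlow, hup] with x using And.intro

theorem ae_eq_of_tendsto_of_tendsto_setIntegral {ν : Measure α} [IsFiniteMeasure ν]
    {f : ℕ → α → ℝ} {g w : α → ℝ} {M : ℝ} {s : Set α} (hs : MeasurableSet s)
    (hf : ∀ n, AEStronglyMeasurable (f n) ν) (hM : ∀ n x, |f n x| ≤ M) (hw : Integrable w ν)
    (h : ∀ t, MeasurableSet t →
      Tendsto (fun n => ∫ x in t, f n x ∂ν) atTop (𝓝 (∫ x in t, w x ∂ν)))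
    (hg : ∀ᵐ x ∂ν.restrict s, Tendsto (fun n => f n x) atTop (𝓝 (g x))) :
    w =ᵐ[ν.restrict s] g := by
  have hgmeas : AEStronglyMeasurable g (ν.restrict s) :=
    aestronglyMeasurable_of_tendsto_ae atTop (fun n => (hf n).restrict) hg
  have hgM : ∀ᵐ x ∂ν.restrict s, ‖g x‖ ≤ M :=
    hg.mono fun x hx => le_of_tendsto hx.norm (.of_forall fun n => hM n x)
  refine Integrable.ae_eq_of_forall_setIntegral_eq _ _ hw.integrableOn
    (.of_bound hgmeas M hgM) fun t ht _ => ?_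
  rw [Measure.restrict_restrict ht]
  refine tendsto_nhds_unique (h (t ∩ s) (ht.inter hs)) ?_
  refine tendsto_integral_of_dominated_convergence (fun _ => M) (fun n => (hf n).restrict)
    (integrable_const M) (fun n => .of_forall (hM n)) ?_
  exact ae_restrict_of_ae_restrict_of_subset inter_subset_right hg

end WeakLimit

end MetricGraph

namespace MetricGraph

theorem countable_setOf_mem_Icc_of_forall_notMem_Ioo (p : ℝ → ℝ → Prop) :
    {t | (∃ a b, a < b ∧ t ∈ Icc a b ∧ p a b) ∧ ∀ a b, p a b → t ∉ Ioo a b}.Countable := by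
  set A := {t | (∃ a b, a < b ∧ t ∈ Icc a b ∧ p a b) ∧ ∀ a b, p a b → t ∉ Ioo a b}
  refine (countable_setOfPred_isolated_right_within (s := A).union
    (countable_setOfPred_isolated_left_within (s := A))).mono ?_
  intro t ht
  obtain ⟨⟨a, b, hab, htab, hp⟩, hnot⟩ := id ht
  have hdisj : ∀ s ∈ A, s ∉ Ioo a b := fun s hs => hs.2 a b hp
  rcases htab.1.eq_or_lt with rfl | hat
  · refine Or.inl ⟨ht, ?_⟩
    rw [inter_comm, nhdsWithin_inter', inf_principal_eq_bot]
    filter_upwards [Ioo_mem_nhdsGT hab] with s hs hsA using hdisj s hsA hs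
  · have htb : t = b := htab.2.eq_of_not_lt fun htb => hnot a b hp ⟨hat, htb⟩
    subst htb
    refine Or.inr ⟨ht, ?_⟩
    rw [inter_comm, nhdsWithin_inter', inf_principal_eq_bot]
    filter_upwards [Ioo_mem_nhdsLT hab] with s hs hsA using hdisj s hsA hs

variable {E : Type*} {G : MetricGraph E} {q : ℕ → G.Point → ℝ} {R : Set G.Point}

theorem pt_eq_pt_iff_of_mem_Ioo {e e' : E} {t t' : ℝ} (ht : t ∈ Ioo 0 (G.len e))
    (ht' : t' ∈ Icc 0 (G.len e')) : G.pt e t = G.pt e' t' ↔ e = e' ∧ t = t' := by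
  refine ⟨fun h => ?_, by rintro ⟨rfl, rfl⟩; rfl⟩
  rw [pt, pt, projIcc_of_mem _ (Ioo_subset_Icc_self ht), projIcc_of_mem _ ht'] at h
  rcases Quotient.exact h with h | ⟨⟨c, d⟩, b, -, h, -⟩ <;> obtain rfl := congrArg Sigma.fst h
  · exact ⟨rfl, congrArg Subtype.val (eq_of_heq (Sigma.mk.inj h).2)⟩
  · have hend := congrArg Subtype.val (eq_of_heq (Sigma.mk.inj h).2)
    cases d
    · exact absurd hend ht.1.ne'
    · exact absurd hend ht.2.ne

theorem injOn_pt (e : E) : InjOn (G.pt e) (Ioo 0 (G.len e)) := fun _ hs _ ht h =>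
  ((pt_eq_pt_iff_of_mem_Ioo hs (Ioo_subset_Icc_self ht)).1 h).2

theorem exists_extension_of_edges (f : E → ℝ → ℝ) {M : ℝ} (hM : 0 ≤ M)
    (hf : ∀ e t, f e t ∈ Icc 0 M) :
    ∃ F : G.Point → ℝ, (∀ x, F x ∈ Icc 0 M) ∧ ∀ e, ∀ t ∈ Ioo 0 (G.len e), F (G.pt e t) = f e t := by
  classical
  let g (x : G.PrePoint) : ℝ := if (x.2 : ℝ) ∈ Ioo 0 (G.len x.1) then f x.1 x.2 else 0
  have hend a : g (G.endPoint a) = 0 := by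
    obtain ⟨e, b⟩ := a
    cases b <;> simp [g, endPoint]
  have hglue : ∀ x y : G.PrePoint, G.glue x y → g x = g y := by
    rintro x y (rfl | ⟨a, b, -, rfl, rfl⟩)
    · rfl
    · rw [hend, hend]
  refine ⟨Quotient.lift g hglue, fun x => ?_, fun e t ht => ?_⟩
  · induction x using Quotient.inductionOn
    simp only [Quotient.lift_mk, g]
    split_ifs
    exacts [hf _ _, ⟨le_rfl, hM⟩]
  · rw [pt, projIcc_of_mem _ (Ioo_subset_Icc_self ht)]
    exact if_pos ht

/-- Every point of `R` inside an edge lies in a nondegenerate closed segment of that edge, on whose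
interior `R` contains the edge and the sequence `q` is eventually regular. -/
def LocallyRegularOn (q : ℕ → G.Point → ℝ) (R : Set G.Point) : Prop :=
  ∀ e, ∀ t ∈ Ioo 0 (G.len e), G.pt e t ∈ R → ∃ a b, a < b ∧ t ∈ Icc a b ∧
    MapsTo (G.pt e) (Ioo a b) R ∧ EventuallyRegular (fun n s => q n (G.pt e s)) a b

namespace LocallyRegularOn

theorem comp (h : LocallyRegularOn q R) {φ : ℕ → ℕ} (hφ : Tendsto φ atTop atTop) :
    LocallyRegularOn (fun n => q (φ n)) R := fun e t ht htR =>
  let ⟨a, b, hab, htab, hR, hreg⟩ := h e t ht htR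
  ⟨a, b, hab, htab, hR, hreg.comp hφ⟩

theorem countable_not_mem_Ioo (h : LocallyRegularOn q R) (e : E) :
    {t | t ∈ Ioo 0 (G.len e) ∧ G.pt e t ∈ R ∧ ∀ a b, MapsTo (G.pt e) (Ioo a b) R ∧
      EventuallyRegular (fun n s => q n (G.pt e s)) a b → t ∉ Ioo a b}.Countable := by
  refine (countable_setOf_mem_Icc_of_forall_notMem_Ioo fun a b => MapsTo (G.pt e) (Ioo a b) R ∧
    EventuallyRegular (fun n s => q n (G.pt e s)) a b).mono ?_
  rintro t ⟨ht, htR, hnot⟩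
  exact ⟨h e t ht htR, hnot⟩

theorem measurableSet (h : LocallyRegularOn q R) (e : E) :
    MeasurableSet {t | t ∈ Ioo 0 (G.len e) ∧ G.pt e t ∈ R} := by
  rw [← union_sdiff_cancel
    (interior_subset (s := {t | t ∈ Ioo 0 (G.len e) ∧ G.pt e t ∈ R}))]
  refine isOpen_interior.measurableSet.union
    ((h.countable_not_mem_Ioo e).mono ?_).measurableSet
  rintro t ⟨⟨ht, htR⟩, hint⟩
  refine ⟨ht, htR, fun a b hab htab => hint (mem_interior.2 ?_)⟩
  exact ⟨_, fun s hs => ⟨hs.1, hab.1 hs.2⟩, isOpen_Ioo.inter isOpen_Ioo, ht, htab⟩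

theorem countable_not_tendsto (h : LocallyRegularOn q R) {M : ℝ} (hM : ∀ n x, |q n x| ≤ M) {e : E}
    {D : Set ℝ} (hD : Dense D)
    (hlim : ∀ r ∈ D, ∃ y, Tendsto (fun n => q n (G.pt e r)) atTop (𝓝 y)) :
    {t | (t ∈ Ioo 0 (G.len e) ∧ G.pt e t ∈ R) ∧
      ¬ ∃ y, Tendsto (fun n => q n (G.pt e t)) atTop (𝓝 y)}.Countable := by
  let bad := {t | ¬ ∃ y, Tendsto (fun n => q n (G.pt e t)) atTop (𝓝 y)}
  let regular := {t | ∃ a b, t ∈ Ioo a b ∧ EventuallyRegular (fun n s => q n (G.pt e s)) a b}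
  have hregular : (regular ∩ bad).Countable := by
    choose! a b hab hreg using fun t (ht : t ∈ regular) => ht
    obtain ⟨S, hS, hSc, hcover⟩ := TopologicalSpace.countable_cover_nhdsWithin
      (f := fun t => Ioo (a t) (b t)) (s := regular)
      fun t ht => mem_nhdsWithin_of_mem_nhds (Ioo_mem_nhds (hab t ht).1 (hab t ht).2)
    refine (hSc.biUnion fun t ht => (hreg t (hS ht)).countable_not_tendsto hD
      (fun n s => hM n _) hlim).mono ?_
    rintro t ⟨ht, htbad⟩
    obtain ⟨s, hs, hts⟩ := mem_iUnion₂.1 (hcover ht)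
    exact mem_iUnion₂.2 ⟨s, hs, hts, htbad⟩
  refine ((h.countable_not_mem_Ioo e).union hregular).mono ?_
  rintro t ⟨⟨ht, htR⟩, htbad⟩
  by_cases htreg : t ∈ regular
  · exact Or.inr ⟨htreg, htbad⟩
  · exact Or.inl ⟨ht, htR, fun a b hab htab => htreg ⟨a, b, htab, hab.2⟩⟩

theorem ae_eq_of_tendsto (h : LocallyRegularOn q R) {M : ℝ} (hq : ∀ n, q n ∈ G.boundedClass M)
    {e : E} (hrat : ∀ r ∈ range ((↑) : ℚ → ℝ), ∃ y,
      Tendsto (fun n => q n (G.pt e r)) atTop (𝓝 y))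
    {w : ℝ → ℝ} (hw : Integrable w (G.edgeMeasure e))
    (hint : ∀ s, MeasurableSet s → Tendsto (fun n => ∫ t in s, q n (G.pt e t) ∂(G.edgeMeasure e))
      atTop (𝓝 (∫ t in s, w t ∂(G.edgeMeasure e))))
    {U : Filter ℕ} [U.NeBot] (hU : U ≤ atTop) {g : G.Point → ℝ}
    (hg : ∀ x ∈ R, Tendsto (fun n => q n x) U (𝓝 (g x))) :
    w =ᵐ[(G.edgeMeasure e).restrict {t | t ∈ Ioo 0 (G.len e) ∧ G.pt e t ∈ R}]
      fun t => g (G.pt e t) := by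
  have hM n x : |q n x| ≤ M := abs_le_of_mem_boundedClass (hq n) x
  refine ae_eq_of_tendsto_of_tendsto_setIntegral (h.measurableSet e) (fun n => (hq n).1 e)
    (fun n t => hM n _) hw hint ?_
  have hgood := (h.countable_not_tendsto hM Rat.denseRange_cast hrat).ae_notMem volume
  filter_upwards [ae_restrict_of_ae (ae_restrict_of_ae hgood),
    ae_restrict_mem (h.measurableSet e)] with t ht htR
  obtain ⟨y, hy⟩ := not_not.1 fun hbad => ht ⟨htR, hbad⟩
  rwa [← tendsto_nhds_unique (hy.mono_left hU) (hg _ htR.2)]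

end LocallyRegularOn

theorem exists_subseq_tendsto_rat_and_tendsto_integral [Finite E] {M : ℝ}
    (hq : ∀ n, q n ∈ G.boundedClass M) :
    ∃ (φ : ℕ → ℕ) (w : E → ℝ → ℝ), StrictMono φ ∧
      (∀ e, ∀ r ∈ range ((↑) : ℚ → ℝ), ∃ y, Tendsto (fun n => q (φ n) (G.pt e r)) atTop (𝓝 y)) ∧
      (∀ e, MemLp (w e) 2 (G.edgeMeasure e)) ∧ ∀ e f, MemLp f 2 (G.edgeMeasure e) →
        Tendsto (fun n => ∫ t, q (φ n) (G.pt e t) * f t ∂(G.edgeMeasure e)) atTop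
          (𝓝 (∫ t, w e t * f t ∂(G.edgeMeasure e))) := by
  obtain ⟨φ, hφ, hlim⟩ := exists_subseq_forall_tendsto_of_countable
    (countable_iUnion fun e => countable_range fun r : ℚ => G.pt e r)
    fun n x _ => abs_le_of_mem_boundedClass (hq n) x
  obtain ⟨ψ, w, hψ, hw, hint⟩ := exists_subseq_tendsto_integral_mul
    (f := fun n e t => q (φ n) (G.pt e t)) (ν := G.edgeMeasure) (fun n => (hq (φ n)).1)
    fun n e t => abs_le_of_mem_boundedClass (hq (φ n)) _
  refine ⟨φ ∘ ψ, w, hφ.comp hψ, ?_, hw, hint⟩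
  rintro e _ ⟨r, rfl⟩
  obtain ⟨y, hy⟩ := hlim (G.pt e r) (mem_iUnion.2 ⟨e, r, rfl⟩)
  exact ⟨y, hy.comp hψ.tendsto_atTop⟩

theorem exists_boundedClass_eqOn_and_ae_eq [Finite E] {M : ℝ} (hM : 0 ≤ M)
    {w : E → ℝ → ℝ} (hw : ∀ e, AEStronglyMeasurable (w e) (G.edgeMeasure e))
    (hwM : ∀ e, ∀ᵐ t ∂(G.edgeMeasure e), w e t ∈ Icc 0 M) {g : G.Point → ℝ}
    (hg : ∀ x, g x ∈ Icc 0 M)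
    (hR : ∀ e, MeasurableSet {t | t ∈ Ioo 0 (G.len e) ∧ G.pt e t ∈ R})
    (hwg : ∀ e, w e =ᵐ[(G.edgeMeasure e).restrict {t | t ∈ Ioo 0 (G.len e) ∧ G.pt e t ∈ R}]
      fun t => g (G.pt e t)) :
    ∃ q₀ ∈ G.boundedClass M, EqOn q₀ g R ∧
      ∀ e, w e =ᵐ[G.edgeMeasure e] fun t => q₀ (G.pt e t) := by
  classical
  obtain ⟨F, hFM, hF⟩ := exists_extension_of_edges (G := G)
    (fun e t => (projIcc 0 M hM (w e t) : ℝ)) hM fun e t => (projIcc 0 M hM (w e t)).2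
  let q₀ := R.piecewise g F
  have hin {x} (hx : x ∈ R) : q₀ x = g x := piecewise_eq_of_mem _ _ _ hx
  have hout {x} (hx : x ∉ R) : q₀ x = F x := piecewise_eq_of_notMem _ _ _ hx
  have hq₀ e : w e =ᵐ[G.edgeMeasure e] fun t => q₀ (G.pt e t) := by
    filter_upwards [hwM e, (ae_restrict_iff' (hR e)).1 (hwg e),
      (ae_edgeMeasure_iff G).2 (.of_forall fun t ht => ht)] with t htM htg ht
    by_cases htR : G.pt e t ∈ R
    · rw [htg ⟨ht, htR⟩, hin htR]
    · rw [hout htR, hF e t ht, projIcc_of_mem hM htM]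
  have hq₀M x : q₀ x ∈ Icc 0 M := by
    by_cases hx : x ∈ R
    · exact hin hx ▸ hg x
    · exact hout hx ▸ hFM x
  exact ⟨q₀, ⟨fun e => (hw e).congr (hq₀ e), hq₀M⟩, fun x => hin, hq₀⟩

theorem LocallyRegularOn.exists_subseq_weakTendsto [Fintype E] (h : LocallyRegularOn q R) {M : ℝ}
    (hM : 0 ≤ M) (hq : ∀ n, q n ∈ G.boundedClass M) :
    ∃ (φ : ℕ → ℕ) (U : Ultrafilter ℕ) (q₀ : G.Point → ℝ), StrictMono φ ∧ (U : Filter ℕ) ≤ atTop ∧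
      q₀ ∈ G.boundedClass M ∧ WeakTendsto (fun n => q (φ n)) q₀ ∧
      ∀ x ∈ R, Tendsto (fun n => q (φ n) x) U (𝓝 (q₀ x)) := by
  obtain ⟨φ, w, hφ, hrat, hw, hint⟩ := exists_subseq_tendsto_rat_and_tendsto_integral hq
  let U := Ultrafilter.of (atTop : Filter ℕ)
  have hU : (U : Filter ℕ) ≤ atTop := Ultrafilter.of_le atTop
  have hlim x : ∃ y ∈ Icc 0 M, Tendsto (fun n => q (φ n) x) U (𝓝 y) :=
    isCompact_Icc.ultrafilter_le_nhds (U.map fun n => q (φ n) x)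
      (le_principal_iff.2 (Filter.mem_map.2 (univ_mem' fun n => (hq (φ n)).2 x)))
  choose g hgM hg using hlim
  have hset e s (hs : MeasurableSet s) : Tendsto (fun n => ∫ t in s, q (φ n) (G.pt e t)
      ∂(G.edgeMeasure e)) atTop (𝓝 (∫ t in s, w e t ∂(G.edgeMeasure e))) := by
    simpa only [integral_mul_indicator_one hs] using
      hint e (s.indicator 1) ((memLp_const 1).indicator hs)
  have hwi e : Integrable (w e) (G.edgeMeasure e) := (hw e).integrable one_le_two
  have hreg := h.comp hφ.tendsto_atTop
  obtain ⟨q₀, hq₀, hq₀g, hwq₀⟩ := exists_boundedClass_eqOn_and_ae_eq hM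
    (fun e => (hw e).aestronglyMeasurable)
    (fun e => ae_mem_Icc_of_tendsto_setIntegral (fun n => (hq (φ n)).1 e)
      (fun n t => (hq (φ n)).2 _) (hwi e) (hset e)) hgM hreg.measurableSet
    fun e => hreg.ae_eq_of_tendsto (fun n => hq (φ n)) (hrat e) (hwi e) (hset e) hU
      fun x _ => hg x
  refine ⟨φ, U, q₀, hφ, hU, hq₀, fun f => tendsto_finsetSum _ fun e _ => ?_, fun x hx => ?_⟩
  · have heq : ∫ t, w e t * f (G.pt e t) ∂(G.edgeMeasure e) =
        ∫ t, q₀ (G.pt e t) * f (G.pt e t) ∂(G.edgeMeasure e) :=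
      integral_congr_ae ((hwq₀ e).mul .rfl)
    exact heq ▸ hint e _ (memLp_edgeMeasure_of_continuousOn
      (f.continuous.comp (continuous_pt G e)).continuousOn)
  · rw [hq₀g hx]
    exact hg x

end MetricGraph

/-! ### Potentials convex along paths -/

namespace MetricGraph

variable {E : Type*} {G : MetricGraph E}

theorem isOpen_image_pt {e : E} {V : Set ℝ} (hV : IsOpen V) (hsub : V ⊆ Ioo 0 (G.len e)) :
    IsOpen (G.pt e '' V) := by
  suffices IsOpen (Quotient.mk G.glue ⁻¹' (G.pt e '' V)) from this
  refine isOpen_sigma_iff.2 fun e' => ?_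
  have hmem (x : Icc 0 (G.len e')) :
      Quotient.mk G.glue ⟨e', x⟩ ∈ G.pt e '' V ↔ e = e' ∧ (x : ℝ) ∈ V := by
    have hx : Quotient.mk G.glue ⟨e', x⟩ = G.pt e' x := by rw [pt, projIcc_val]
    rw [hx]
    refine ⟨?_, by rintro ⟨rfl, hxV⟩; exact mem_image_of_mem _ hxV⟩
    rintro ⟨t, ht, htx⟩
    obtain ⟨rfl, rfl⟩ := (pt_eq_pt_iff_of_mem_Ioo (hsub ht) x.2).1 htx
    exact ⟨rfl, ht⟩
  by_cases he : e = e'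
  · convert hV.preimage (continuous_subtype_val (p := (· ∈ Icc 0 (G.len e')))) using 1
    ext x
    exact (hmem x).trans (and_iff_right he)
  · convert isOpen_empty
    exact eq_empty_of_forall_notMem fun x hx => he ((hmem x).1 hx).1

theorem isOpenMap_restrict_pt (e : E) : IsOpenMap ((Ioo 0 (G.len e)).domRestrict (G.pt e)) := by
  intro V hV
  rw [domRestrict_eq, image_comp]
  exact isOpen_image_pt (isOpen_Ioo.isOpenMap_subtype_val V hV) (Subtype.coe_image_subset _ V)

theorem setLength_image_pt [Fintype E] {e : E} {x y : ℝ} (hx : x ∈ Ioo 0 (G.len e))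
    (hy : y ∈ Ioo 0 (G.len e)) : G.setLength (G.pt e '' uIcc x y) = |y - x| := by
  have hsub : uIcc x y ⊆ Ioo 0 (G.len e) := ordConnected_Ioo.uIcc_subset hx hy
  rw [setLength, Finset.sum_eq_single_of_mem e (Finset.mem_univ e)]
  · have hset : {t | t ∈ Icc 0 (G.len e) ∧ G.pt e t ∈ G.pt e '' uIcc x y} = uIcc x y := by
      ext t
      refine ⟨?_, fun ht => ⟨Ioo_subset_Icc_self (hsub ht), mem_image_of_mem _ ht⟩⟩
      rintro ⟨ht, s, hs, hst⟩
      rwa [← ((pt_eq_pt_iff_of_mem_Ioo (hsub hs) ht).1 hst).2]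
    rw [hset, Real.volume_interval, ENNReal.toReal_ofReal (abs_nonneg _)]
  · intro e' _ he'
    rw [(eq_empty_of_forall_notMem _ : {t | t ∈ Icc 0 (G.len e') ∧ _} = ∅), measure_empty,
      ENNReal.toReal_zero]
    rintro t ⟨ht, s, hs, hst⟩
    exact he' ((pt_eq_pt_iff_of_mem_Ioo (hsub hs) ht).1 hst).1.symm

/-- On `[s₁, s₂]` the curve `f` stays in the interior of the edge `e`, where it has the coordinate
`c`, and it is injective there. -/
structure IsChart (f : ℝ → G.Point) (e : E) (s₁ s₂ : ℝ) (c : ℝ → ℝ) : Prop where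
  lt : s₁ < s₂
  continuousOn : ContinuousOn c (Icc s₁ s₂)
  injOn : InjOn c (Icc s₁ s₂)
  mapsTo : MapsTo c (Icc s₁ s₂) (Ioo 0 (G.len e))
  eqOn : EqOn f (G.pt e ∘ c) (Icc s₁ s₂)

theorem exists_isChart {f : ℝ → G.Point} {a b s₀ t₀ : ℝ} {e : E} (hab : a < b) (hf : Continuous f)
    (hinj : InjOn f (Icc a b)) (hs₀ : s₀ ∈ Icc a b) (ht₀ : t₀ ∈ Ioo 0 (G.len e))
    (h : f s₀ = G.pt e t₀) :
    ∃ s₁ s₂ c, IsChart f e s₁ s₂ c ∧ Icc s₁ s₂ ⊆ Icc a b ∧ s₀ ∈ Icc s₁ s₂ := by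
  let coord := Function.invFunOn (G.pt e) (Ioo 0 (G.len e))
  have hcoord : ContinuousOn coord (G.pt e '' Ioo 0 (G.len e)) :=
    (isOpenMap_restrict_pt e).continuousOn_image_of_leftInvOn (injOn_pt e).leftInvOn_invFunOn
  obtain ⟨ε, hε, hsub⟩ := (nhds_basis_Icc_pos s₀).mem_iff.1
    (((isOpen_image_pt isOpen_Ioo Subset.rfl).preimage hf).mem_nhds ⟨t₀, ht₀, h.symm⟩)
  refine ⟨max a (s₀ - ε), min b (s₀ + ε), coord ∘ f, ?_,
    Icc_subset_Icc (le_max_left _ _) (min_le_left _ _),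
    max_le hs₀.1 (by linarith), le_min hs₀.2 (by linarith)⟩
  have hmem : MapsTo f (Icc (max a (s₀ - ε)) (min b (s₀ + ε))) (G.pt e '' Ioo 0 (G.len e)) :=
    fun s hs => hsub ⟨(le_max_right _ _).trans hs.1, hs.2.trans (min_le_right _ _)⟩
  have heq : EqOn f (G.pt e ∘ coord ∘ f) (Icc (max a (s₀ - ε)) (min b (s₀ + ε))) :=
    fun s hs => (Function.invFunOn_eq (hmem hs)).symm
  exact
    { lt := max_lt (lt_min hab (by linarith [hs₀.1])) (lt_min (by linarith [hs₀.2]) (by linarith))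
      continuousOn := hcoord.comp hf.continuousOn hmem
      injOn := fun x hx y hy hxy =>
        hinj ⟨(le_max_left _ _).trans hx.1, hx.2.trans (min_le_left _ _)⟩
          ⟨(le_max_left _ _).trans hy.1, hy.2.trans (min_le_left _ _)⟩
          ((heq hx).trans ((congrArg (G.pt e) hxy).trans (heq hy).symm))
      mapsTo := fun s hs => Function.invFunOn_mem (hmem hs)
      eqOn := heq }

namespace IsChart

variable {f : ℝ → G.Point} {e : E} {s₁ s₂ : ℝ} {c : ℝ → ℝ}

theorem strictMonoOn_or_strictAntiOn (h : IsChart f e s₁ s₂ c) :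
    StrictMonoOn c (Icc s₁ s₂) ∨ StrictAntiOn c (Icc s₁ s₂) :=
  h.continuousOn.strictMonoOn_of_injOn_Icc' h.lt.le h.injOn

theorem image_Icc (h : IsChart f e s₁ s₂ c) {r s : ℝ} (hr : r ∈ Icc s₁ s₂) (hs : s ∈ Icc s₁ s₂)
    (hrs : r ≤ s) : c '' Icc r s = uIcc (c r) (c s) := by
  have hsub : Icc r s ⊆ Icc s₁ s₂ := Icc_subset_Icc hr.1 hs.2
  have hc := h.continuousOn.mono hsub
  rcases h.strictMonoOn_or_strictAntiOn with hmono | hanti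
  · rw [hc.image_Icc_of_monotoneOn hrs (hmono.monotoneOn.mono hsub),
      uIcc_of_le (hmono.monotoneOn hr hs hrs)]
  · rw [hc.image_Icc_of_antitoneOn hrs (hanti.antitoneOn.mono hsub),
      uIcc_of_ge (hanti.antitoneOn hr hs hrs)]

theorem image_Icc_eq_image_pt (h : IsChart f e s₁ s₂ c) {r s : ℝ} (hr : r ∈ Icc s₁ s₂)
    (hs : s ∈ Icc s₁ s₂) (hrs : r ≤ s) : f '' Icc r s = G.pt e '' uIcc (c r) (c s) := by
  rw [← h.image_Icc hr hs hrs, ← image_comp]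
  exact (h.eqOn.mono (Icc_subset_Icc hr.1 hs.2)).image_eq

theorem exists_eq_of_mem_Ioo (h : IsChart f e s₁ s₂ c) {t : ℝ}
    (ht : t ∈ Ioo (min (c s₁) (c s₂)) (max (c s₁) (c s₂))) : ∃ s ∈ Icc s₁ s₂, c s = t := by
  have hmem : t ∈ uIcc (c s₁) (c s₂) := Ioo_subset_Icc_self ht
  rwa [← h.image_Icc (left_mem_Icc.2 h.lt.le) (right_mem_Icc.2 h.lt.le) h.lt.le] at hmem

theorem eventuallyRegular {q : ℕ → G.Point → ℝ} (h : IsChart f e s₁ s₂ c)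
    (hq : ∀ᶠ n in atTop, AntitoneOn (q n ∘ f) (Icc s₁ s₂)) :
    EventuallyRegular (fun n t => q n (G.pt e t)) (min (c s₁) (c s₂)) (max (c s₁) (c s₂)) := by
  have hval {n s} (hs : s ∈ Icc s₁ s₂) : q n (G.pt e (c s)) = (q n ∘ f) s :=
    congrArg (q n) (h.eqOn hs).symm
  rcases h.strictMonoOn_or_strictAntiOn with hmono | hanti
  · refine Or.inr (Or.inl (hq.mono fun n hn x hx y hy hxy => ?_))
    obtain ⟨r, hr, rfl⟩ := h.exists_eq_of_mem_Ioo hx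
    obtain ⟨s, hs, rfl⟩ := h.exists_eq_of_mem_Ioo hy
    simpa only [hval hr, hval hs] using hn hr hs ((hmono.le_iff_le hr hs).1 hxy)
  · refine Or.inl (hq.mono fun n hn x hx y hy hxy => ?_)
    obtain ⟨r, hr, rfl⟩ := h.exists_eq_of_mem_Ioo hx
    obtain ⟨s, hs, rfl⟩ := h.exists_eq_of_mem_Ioo hy
    simpa only [hval hr, hval hs] using hn hs hr ((hanti.le_iff_ge hr hs).1 hxy)

end IsChart

theorem locallyRegularOn_of_curves {q : ℕ → G.Point → ℝ} {R : Set G.Point}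
    (h : ∀ x ∈ R, ∃ (f : ℝ → G.Point) (a b : ℝ), a < b ∧ Continuous f ∧ InjOn f (Icc a b) ∧
      x ∈ f '' Icc a b ∧ f '' Icc a b ⊆ R ∧
      ∀ e s₁ s₂ c, IsChart f e s₁ s₂ c → Icc s₁ s₂ ⊆ Icc a b →
        EventuallyRegular (fun n t => q n (G.pt e t)) (min (c s₁) (c s₂)) (max (c s₁) (c s₂))) :
    LocallyRegularOn q R := by
  intro e t ht htR
  obtain ⟨f, a, b, hab, hf, hinj, ⟨s₀, hs₀, hft⟩, hsub, hreg⟩ := h _ htR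
  obtain ⟨s₁, s₂, c, hc, hsub', hs₀'⟩ := exists_isChart hab hf hinj hs₀ ht hft
  have hc₀ : c s₀ = t := ((pt_eq_pt_iff_of_mem_Ioo (hc.mapsTo hs₀') (Ioo_subset_Icc_self ht)).1
    ((hc.eqOn hs₀').symm.trans hft)).2
  have hs₁ := left_mem_Icc.2 hc.lt.le
  have hs₂ := right_mem_Icc.2 hc.lt.le
  refine ⟨_, _, inf_lt_sup.2 fun heq => hc.lt.ne (hc.injOn hs₁ hs₂ heq), ?_, fun t' ht' => ?_,
    hreg e s₁ s₂ c hc hsub'⟩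
  · change t ∈ uIcc (c s₁) (c s₂)
    rw [← hc.image_Icc hs₁ hs₂ hc.lt.le]
    exact ⟨s₀, hs₀', hc₀⟩
  · obtain ⟨s, hs, rfl⟩ := hc.exists_eq_of_mem_Ioo ht'
    rw [← Function.comp_apply (f := G.pt e), ← hc.eqOn hs]
    exact hsub (mem_image_of_mem f (hsub' hs))

namespace GPath

/-- The path `γ` as a curve on the real line, constant on `(-∞, 0]` and on `[1, ∞)`. -/
noncomputable def ext (γ : G.GPath) (s : ℝ) : G.Point := γ.map (projIcc 0 1 zero_le_one s)

theorem continuous_ext (γ : G.GPath) : Continuous γ.ext :=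
  γ.map.continuous.comp continuous_projIcc

theorem ext_coe (γ : G.GPath) (s : unitInterval) : γ.ext s = γ.map s := by
  rw [ext, projIcc_val]

theorem image_ext_Icc (γ : G.GPath) (r s : unitInterval) :
    γ.ext '' Icc (r : ℝ) s = γ.map '' Icc r s := by
  have hIcc : Icc (r : ℝ) s = (↑) '' Icc r s := by
    rw [image_subtype_val_Icc]
  rw [hIcc, ← image_comp]
  exact image_congr fun x _ => γ.ext_coe x

theorem injOn_ext (γ : G.GPath) {A : Set ℝ} (hA : A ⊆ Icc 0 1)
    (hends : 0 ∈ A → 1 ∈ A → γ.map 0 ≠ γ.map 1) : InjOn γ.ext A := by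
  have hne : ∀ s ∈ A, ∀ t ∈ A, s < t → γ.ext s ≠ γ.ext t := by
    intro s hs t ht hst h
    lift s to unitInterval using hA hs
    lift t to unitInterval using hA ht
    rw [ext_coe, ext_coe] at h
    obtain ⟨rfl, rfl⟩ := γ.inj s t hst h
    exact hends hs ht h
  intro s hs t ht h
  by_contra hst
  rcases lt_or_gt_of_ne hst with hlt | hlt
  exacts [hne s hs t ht hlt h, hne t ht s hs hlt h.symm]

end GPath

section Convex

variable [Fintype E] {γ : G.GPath}

theorem IsChart.setLength_image_map {e : E} {s₁ s₂ : ℝ} {c : ℝ → ℝ}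
    (h : IsChart γ.ext e s₁ s₂ c) {r s : unitInterval} (hr : (r : ℝ) ∈ Icc s₁ s₂)
    (hs : (s : ℝ) ∈ Icc s₁ s₂) (hrs : r ≤ s) : G.setLength (γ.map '' Icc r s) = |c s - c r| := by
  rw [← γ.image_ext_Icc, h.image_Icc_eq_image_pt hr hs hrs,
    setLength_image_pt (h.mapsTo hr) (h.mapsTo hs)]

theorem ConvexAlong.convexOn_chart {ρ : G.Point → ℝ} (hρ : G.ConvexAlong ρ γ) {e : E} {s₁ s₂ : ℝ}
    {c : ℝ → ℝ} (h : IsChart γ.ext e s₁ s₂ c) (hsub : Icc s₁ s₂ ⊆ Icc 0 1) :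
    ConvexOn ℝ (Ioo (min (c s₁) (c s₂)) (max (c s₁) (c s₂))) fun t => ρ (G.pt e t) := by
  have hineq {r s t : ℝ} (hr : r ∈ Icc s₁ s₂) (hs : s ∈ Icc s₁ s₂) (ht : t ∈ Icc s₁ s₂)
      (hrs : r ≤ s) (hst : s ≤ t) :
      |c t - c r| * ρ (G.pt e (c s)) ≤
        |c t - c s| * ρ (G.pt e (c r)) + |c s - c r| * ρ (G.pt e (c t)) := by
    have hval {s : ℝ} (hs : s ∈ Icc s₁ s₂) : G.pt e (c s) = γ.ext s := (h.eqOn hs).symm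
    rw [hval hr, hval hs, hval ht]
    lift r to unitInterval using hsub hr
    lift s to unitInterval using hsub hs
    lift t to unitInterval using hsub ht
    simpa only [GPath.ext_coe, h.setLength_image_map hr ht (hrs.trans hst),
      h.setLength_image_map hs ht hst, h.setLength_image_map hr hs hrs] using hρ r s t hrs hst
  refine convexOn_of_slope_mono_adjacent (convex_Ioo _ _) fun {x y z} hx hz hxy hyz => ?_
  obtain ⟨s, hs, rfl⟩ := h.exists_eq_of_mem_Ioo ⟨hx.1.trans hxy, hyz.trans hz.2⟩
  obtain ⟨r, hr, rfl⟩ := h.exists_eq_of_mem_Ioo hx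
  obtain ⟨t, ht, rfl⟩ := h.exists_eq_of_mem_Ioo hz
  rw [div_le_div_iff₀ (sub_pos.2 hxy) (sub_pos.2 hyz)]
  rcases h.strictMonoOn_or_strictAntiOn with hmono | hanti
  · have := hineq hr hs ht ((hmono.lt_iff_lt hr hs).1 hxy).le ((hmono.lt_iff_lt hs ht).1 hyz).le
    rw [abs_of_pos (by linarith), abs_of_pos (by linarith), abs_of_pos (by linarith)] at this
    linarith
  · have := hineq ht hs hr ((hanti.lt_iff_gt hs ht).1 hyz).le ((hanti.lt_iff_gt hr hs).1 hxy).le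
    rw [abs_of_neg (by linarith), abs_of_neg (by linarith), abs_of_neg (by linarith)] at this
    linarith

theorem locallyRegularOn_of_mem_convexClass {P : Set G.GPath} {M : ℝ} {q : ℕ → G.Point → ℝ}
    (hq : ∀ n, q n ∈ G.convexClass P M) : LocallyRegularOn q (⋃ γ ∈ P, range γ.map) := by
  refine locallyRegularOn_of_curves fun x hx => ?_
  obtain ⟨γ, hγ, s, rfl⟩ := mem_iUnion₂.1 hx
  -- A closed path is not injective on `[0, 1]`, hence the two halves.
  obtain ⟨a, b, hab, hs, hsub, hends⟩ : ∃ a b : ℝ, a < b ∧ (s : ℝ) ∈ Icc a b ∧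
      Icc a b ⊆ Icc 0 1 ∧ ((0 : ℝ) ∈ Icc a b → (1 : ℝ) ∉ Icc a b) := by
    rcases le_total (s : ℝ) (1 / 2) with hs | hs
    · exact ⟨0, 1 / 2, by norm_num, ⟨s.2.1, hs⟩, Icc_subset_Icc le_rfl (by norm_num),
        fun _ h => by norm_num at h⟩
    · exact ⟨1 / 2, 1, by norm_num, ⟨hs, s.2.2⟩, Icc_subset_Icc (by norm_num) le_rfl,
        fun h => by norm_num at h⟩
  refine ⟨γ.ext, a, b, hab, γ.continuous_ext, γ.injOn_ext hsub fun h₀ h₁ => (hends h₀ h₁).elim,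
    ⟨s, hs, γ.ext_coe s⟩, ?_, fun e s₁ s₂ c hc hsub' => Or.inr (Or.inr (.of_forall fun n =>
      ((hq n).2 γ hγ).convexOn_chart hc (hsub'.trans hsub)))⟩
  rintro _ ⟨r, -, rfl⟩
  exact mem_iUnion₂.2 ⟨γ, hγ, mem_range_self _⟩

theorem exists_subseq_weakTendsto_convexClass {P : Set G.GPath} {M : ℝ} (hM : 0 ≤ M)
    {q : ℕ → G.Point → ℝ} (hq : ∀ n, q n ∈ G.convexClass P M) :
    ∃ (φ : ℕ → ℕ) (q₀ : G.Point → ℝ), StrictMono φ ∧ q₀ ∈ G.convexClass P M ∧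
      WeakTendsto (fun n => q (φ n)) q₀ := by
  obtain ⟨φ, U, q₀, hφ, -, hq₀, hweak, hlim⟩ :=
    (locallyRegularOn_of_mem_convexClass hq).exists_subseq_weakTendsto hM fun n => (hq n).1
  refine ⟨φ, q₀, hφ, ⟨hq₀, fun γ hγ r s t hrs hst => ?_⟩, hweak⟩
  have hlim' s : Tendsto (fun n => q (φ n) (γ.map s)) U (𝓝 (q₀ (γ.map s))) :=
    hlim _ (mem_iUnion₂.2 ⟨γ, hγ, mem_range_self s⟩)
  exact le_of_tendsto_of_tendsto ((hlim' s).const_mul _)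
    (((hlim' r).const_mul _).add ((hlim' t).const_mul _))
    (.of_forall fun n => (hq (φ n)).2 γ hγ r s t hrs hst)

end Convex

end MetricGraph

/-! ### Single-well potentials -/

namespace MetricGraph

theorem t2Space_of_isClosedMap {X Y : Type*} [TopologicalSpace X] [TopologicalSpace Y] [T4Space X]
    {f : X → Y} (hclosed : IsClosedMap f) (hf : Continuous f) (hsurj : Function.Surjective f) :
    T2Space Y := by
  have hsingle (y : Y) : IsClosed ({y} : Set Y) := by
    obtain ⟨x, rfl⟩ := hsurj y
    rw [← image_singleton]
    exact hclosed _ isClosed_singleton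
  refine t2Space_iff_disjoint_nhds.2 fun x y hxy => (disjoint_comap_iff hsurj).1 ?_
  rw [hclosed.comap_nhds_eq hf, hclosed.comap_nhds_eq hf]
  exact disjoint_nhdsSet_nhdsSet ((hsingle x).preimage hf) ((hsingle y).preimage hf)
    ((disjoint_singleton.2 hxy).preimage f)

theorem exists_continuous_injOn_concat {X : Type*} [TopologicalSpace X] {f g : ℝ → X} {a b c : ℝ}
    (hf : Continuous f) (hg : Continuous g) (hfg : f b = g b) (hfinj : InjOn f (Icc a b))
    (hginj : InjOn g (Icc b c)) (hdisj : Disjoint (f '' Ico a b) (g '' Icc b c)) :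
    ∃ k : ℝ → X, Continuous k ∧ EqOn k f (Iic b) ∧ EqOn k g (Ici b) ∧ InjOn k (Icc a c) := by
  let k (s : ℝ) : X := if s ≤ b then f s else g s
  have hkf : EqOn k f (Iic b) := fun s hs => if_pos hs
  have hkg : EqOn k g (Ici b) := by
    intro s hs
    rcases eq_or_lt_of_le (mem_Ici.1 hs) with rfl | hbs
    · rw [hkf (mem_Iic.2 le_rfl), hfg]
    · exact if_neg hbs.not_ge
  have hne : ∀ s ∈ Icc a c, ∀ t ∈ Icc a c, s < t → k s ≠ k t := by
    intro s hs t ht hst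
    rcases le_total b s with hbs | hsb
    · rw [hkg hbs, hkg (hbs.trans hst.le)]
      exact fun h => hst.ne (hginj ⟨hbs, hs.2⟩ ⟨hbs.trans hst.le, ht.2⟩ h)
    rcases le_or_gt t b with htb | hbt
    · rw [hkf hsb, hkf htb]
      exact fun h => hst.ne (hfinj ⟨hs.1, hsb⟩ ⟨ht.1, htb⟩ h)
    rcases hsb.eq_or_lt with rfl | hsb
    · rw [hkg self_mem_Ici, hkg hbt.le]
      exact fun h => hst.ne (hginj ⟨le_rfl, hs.2⟩ ⟨hbt.le, ht.2⟩ h)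
    · rw [hkf hsb.le, hkg hbt.le]
      exact hdisj.ne_of_mem (mem_image_of_mem f ⟨hs.1, hsb⟩)
        (mem_image_of_mem g ⟨hbt.le, ht.2⟩)
  refine ⟨k, Continuous.if_le hf hg continuous_id continuous_const (by rintro _ rfl; exact hfg),
    hkf, hkg, fun s hs t ht h => ?_⟩
  by_contra hst
  rcases lt_or_gt_of_ne hst with hlt | hlt
  exacts [hne s hs t ht hlt h, hne t ht s hs hlt h.symm]

theorem exists_continuous_injective_mapsTo_uIcc (r₀ r₁ b : ℝ) :
    ∃ p : ℝ → ℝ, Continuous p ∧ Function.Injective p ∧ p b = r₀ ∧ p (b + |r₁ - r₀|) = r₁ ∧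
      MapsTo p (Icc b (b + |r₁ - r₀|)) (uIcc r₀ r₁) := by
  rcases le_total r₀ r₁ with h | h
  · rw [abs_of_nonneg (sub_nonneg.2 h), uIcc_of_le h]
    exact ⟨fun s => r₀ + (s - b), by fun_prop, fun s t hst => by simpa using hst, by simp, by simp,
      fun s hs => ⟨by linarith [hs.1], by linarith [hs.2]⟩⟩
  · rw [abs_of_nonpos (sub_nonpos.2 h), uIcc_of_ge h]
    exact ⟨fun s => r₀ - (s - b), by fun_prop, fun s t hst => by simpa using hst, by simp, by simp,
      fun s hs => ⟨by linarith [hs.2], by linarith [hs.1]⟩⟩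

variable {E : Type*} {G : MetricGraph E}

theorem isClosedMap_mk_glue [Finite E] : IsClosedMap (Quotient.mk G.glue) := by
  intro Z hZ
  have heq : Quotient.mk G.glue ⁻¹' (Quotient.mk G.glue '' Z) =
      Z ∪ (Quotient.mk G.glue ⁻¹' (Quotient.mk G.glue '' Z) ∩ range G.endPoint) := by
    refine Subset.antisymm ?_ (union_subset (subset_preimage_image _ _) inter_subset_left)
    rintro x ⟨z, hz, hzx⟩
    rcases Quotient.exact hzx with rfl | ⟨a, b, -, -, rfl⟩
    · exact Or.inl hz
    · exact Or.inr ⟨⟨z, hz, hzx⟩, mem_range_self b⟩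
  refine (isQuotientMap_quotient_mk' (s := G.glue)).isClosed_preimage.1 (heq ▸ ?_)
  exact hZ.union ((finite_range G.endPoint).inter_of_right _).isClosed

instance [Finite E] : T2Space G.Point :=
  t2Space_of_isClosedMap isClosedMap_mk_glue continuous_quotient_mk' Quotient.mk_surjective

theorem injOn_pt_uIcc {e : E} {x y : ℝ} (hx : x ∈ Icc 0 (G.len e)) (hy : y ∈ Icc 0 (G.len e))
    (hxy : |y - x| < G.len e) : InjOn (G.pt e) (uIcc x y) := by
  intro s hs t ht hst
  have hsub : uIcc x y ⊆ Icc 0 (G.len e) := uIcc_subset_Icc hx hy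
  have hdist : |t - s| < G.len e :=
    (abs_sub_le_of_uIcc_subset_uIcc (uIcc_subset_uIcc hs ht)).trans_lt hxy
  rcases eq_endpoints_or_mem_Ioo_of_mem_Icc (hsub hs) with hs₀ | hs₀ | hs₀
  · rcases eq_endpoints_or_mem_Ioo_of_mem_Icc (hsub ht) with ht₀ | ht₀ | ht₀
    · rw [hs₀, ht₀]
    · rw [hs₀, ht₀, sub_zero] at hdist
      exact absurd (le_abs_self _) hdist.not_ge
    · exact ((pt_eq_pt_iff_of_mem_Ioo ht₀ (hsub hs)).1 hst.symm).2.symm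
  · rcases eq_endpoints_or_mem_Ioo_of_mem_Icc (hsub ht) with ht₀ | ht₀ | ht₀
    · rw [hs₀, ht₀, zero_sub, abs_neg] at hdist
      exact absurd (le_abs_self _) hdist.not_ge
    · rw [hs₀, ht₀]
    · exact ((pt_eq_pt_iff_of_mem_Ioo ht₀ (hsub hs)).1 hst.symm).2.symm
  · exact ((pt_eq_pt_iff_of_mem_Ioo hs₀ (hsub ht)).1 hst).2

theorem GPath.eventually_notMem_image_uIcc [Finite E] (γ : G.GPath) (hγ : γ.map 0 ≠ γ.map 1) {e : E}
    {τ : ℕ → ℝ} {τ₀ : ℝ} (hτ : Tendsto τ atTop (𝓝 τ₀)) (hγτ : γ.map 1 = G.pt e τ₀) {S : ℝ}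
    (hS : S < 1) :
    ∀ᶠ n in atTop, ∀ s ∈ Icc 0 S, γ.ext s ∉ G.pt e '' uIcc (τ n) τ₀ := by
  have hclosed : IsClosed (γ.ext '' Icc 0 S) := (isCompact_Icc.image γ.continuous_ext).isClosed
  have hτ₀ : G.pt e τ₀ ∉ γ.ext '' Icc 0 S := by
    rintro ⟨s, hs, hsτ⟩
    refine (hs.2.trans_lt hS).ne (γ.injOn_ext Subset.rfl (fun _ _ => hγ) ⟨hs.1, by linarith [hs.2]⟩
      (right_mem_Icc.2 zero_le_one) ?_)
    rw [hsτ, ← hγτ]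
    exact (γ.ext_coe 1).symm
  have hV : G.pt e ⁻¹' (γ.ext '' Icc 0 S)ᶜ ∈ 𝓝 τ₀ :=
    (continuous_pt G e).continuousAt.preimage_mem_nhds (hclosed.isOpen_compl.mem_nhds hτ₀)
  filter_upwards [(hτ.uIcc tendsto_const_nhds).eventually (eventually_smallSets_subset.2 hV)]
    with n hn s hs
  rintro ⟨t, ht, hts⟩
  exact hn ht ⟨s, hs, hts.symm⟩

theorem IsSubgraph.exists_subseq {T : Set G.Point} (hT : G.IsSubgraph T) {a : ℕ → G.Point}
    (ha : ∀ n, a n ∈ T) :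
    ∃ (e : E) (α β : ℝ) (φ : ℕ → ℕ) (τ : ℕ → ℝ) (τ₀ : ℝ), Icc α β ⊆ Icc 0 (G.len e) ∧
      MapsTo (G.pt e) (Icc α β) T ∧ StrictMono φ ∧ (∀ n, τ n ∈ Icc α β) ∧
      (∀ n, a (φ n) = G.pt e (τ n)) ∧ τ₀ ∈ Icc α β ∧ Tendsto τ atTop (𝓝 τ₀) := by
  obtain ⟨S, hS, rfl⟩ := hT
  obtain ⟨p, hp, hfreq⟩ : ∃ p ∈ S, ∃ᶠ n in atTop, a n ∈ G.pt p.1 '' Icc p.2.1 p.2.2 := by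
    by_contra! hcon
    obtain ⟨n, hn⟩ := ((eventually_all_finset S).2 hcon).exists
    obtain ⟨p, hp, hap⟩ := mem_iUnion₂.1 (ha n)
    exact hn p hp hap
  obtain ⟨φ, hφ, hmem⟩ := extraction_of_frequently_atTop hfreq
  choose τ hτ hτa using hmem
  obtain ⟨τ₀, hτ₀, ψ, hψ, hlim⟩ := isCompact_Icc.tendsto_subseq hτ
  exact ⟨p.1, p.2.1, p.2.2, φ ∘ ψ, τ ∘ ψ, τ₀, Icc_subset_Icc (hS p hp).1 (hS p hp).2.2,
    fun t ht => mem_iUnion₂.2 ⟨p, hp, mem_image_of_mem _ ht⟩, hφ.comp hψ, fun n => hτ _,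
    fun n => (hτa _).symm, hτ₀, hlim⟩

end MetricGraph

namespace MetricGraph

variable {E : Type*} {G : MetricGraph E} {T : Set G.Point}

/-- The paths in `T` from a leaf of `T` to the point `a`. -/
def leafPaths (T : Set G.Point) (a : G.Point) : Set G.GPath :=
  {γ | range γ.map ⊆ T ∧ γ.map 0 ∈ G.leaves T ∧ γ.map 1 = a}

/-- The point `a` can serve as the bottom of the well in the definition of a potential that is
single-well on `T`. -/
def IsWellBottom (T : Set G.Point) (ρ : G.Point → ℝ) (a : G.Point) : Prop :=
  ∀ γ ∈ leafPaths T a, Antitone fun s => ρ (γ.map s)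

namespace IsWellBottom

variable {ρ : G.Point → ℝ}

theorem antitoneOn {a : G.Point} (h : IsWellBottom T ρ a) {f : ℝ → G.Point} {c : ℝ} (hc : 0 < c)
    (hf : Continuous f) (hinj : InjOn f (Icc 0 c)) (hfT : MapsTo f (Icc 0 c) T)
    (hf₀ : f 0 ∈ G.leaves T) (hfc : f c = a) : AntitoneOn (ρ ∘ f) (Icc 0 c) := by
  have hmem (s : unitInterval) : c * s ∈ Icc 0 c :=
    ⟨mul_nonneg hc.le s.2.1, mul_le_of_le_one_right hc.le s.2.2⟩
  let γ : G.GPath :=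
    { map := ⟨fun s => f (c * s), by fun_prop⟩
      inj := fun s t hst heq => absurd
        (Subtype.ext (mul_left_cancel₀ hc.ne' (hinj (hmem s) (hmem t) heq))) hst.ne }
  have hγ : γ ∈ leafPaths T a := by
    refine ⟨range_subset_iff.2 fun s => hfT (hmem s), ?_, ?_⟩
    · change f (c * 0) ∈ G.leaves T
      rwa [mul_zero]
    · change f (c * 1) = a
      rwa [mul_one]
  intro s hs t ht hst
  have hdiv {r : ℝ} (hr : r ∈ Icc 0 c) : r / c ∈ unitInterval :=
    ⟨div_nonneg hr.1 hc.le, (div_le_one hc).2 hr.2⟩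
  have hle := h γ hγ (a := ⟨s / c, hdiv hs⟩) (b := ⟨t / c, hdiv ht⟩)
    (div_le_div_of_nonneg_right hst hc.le)
  change ρ (f (c * (t / c))) ≤ ρ (f (c * (s / c))) at hle
  rwa [mul_div_cancel₀ _ hc.ne', mul_div_cancel₀ _ hc.ne'] at hle

theorem antitoneOn_of_segment {e : E} {r₀ r₁ s₀ : ℝ} (h : IsWellBottom T ρ (G.pt e r₁))
    {f : ℝ → G.Point} (hs₀ : 0 < s₀) (hf : Continuous f) (hfinj : InjOn f (Icc 0 s₀))
    (hfT : MapsTo f (Icc 0 s₀) T) (hf₀ : f 0 ∈ G.leaves T) (hfs₀ : f s₀ = G.pt e r₀)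
    (hptinj : InjOn (G.pt e) (uIcc r₀ r₁)) (hptT : MapsTo (G.pt e) (uIcc r₀ r₁) T)
    (hdisj : ∀ s ∈ Ico 0 s₀, f s ∉ G.pt e '' uIcc r₀ r₁) : AntitoneOn (ρ ∘ f) (Icc 0 s₀) := by
  obtain ⟨p, hp, hpinj, hp₀, hp₁, hpmem⟩ := exists_continuous_injective_mapsTo_uIcc r₀ r₁ s₀
  set c := s₀ + |r₁ - r₀|
  have hle : s₀ ≤ c := le_add_of_nonneg_right (abs_nonneg _)
  obtain ⟨k, hk, hkf, hkp, hkinj⟩ := exists_continuous_injOn_concat (g := G.pt e ∘ p) (a := 0)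
    (b := s₀) (c := c) hf ((continuous_pt G e).comp hp) (by rw [hfs₀, Function.comp_apply, hp₀])
    hfinj (hptinj.comp hpinj.injOn hpmem) (disjoint_left.2 <| by
      rintro _ ⟨s, hs, rfl⟩ ⟨t, ht, hts⟩
      exact hdisj s hs ⟨p t, hpmem ht, hts⟩)
  have hkT : MapsTo k (Icc 0 c) T := by
    intro s hs
    rcases le_total s s₀ with hss | hss
    · exact hkf (mem_Iic.2 hss) ▸ hfT ⟨hs.1, hss⟩
    · exact hkp (mem_Ici.2 hss) ▸ hptT (hpmem ⟨hss, hs.2⟩)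
  have hanti := h.antitoneOn (hs₀.trans_le hle) hk hkinj hkT (hkf (mem_Iic.2 hs₀.le) ▸ hf₀)
    (by rw [hkp (mem_Ici.2 hle), Function.comp_apply, hp₁])
  refine (hanti.mono (Icc_subset_Icc_right hle)).congr fun s hs => ?_
  exact congrArg ρ (hkf (mem_Iic.2 hs.2))

end IsWellBottom

theorem eventually_antitoneOn_ext [Finite E] {q : ℕ → G.Point → ℝ} {e : E} {α β : ℝ}
    (hlen : Icc α β ⊆ Icc 0 (G.len e)) (hptT : MapsTo (G.pt e) (Icc α β) T) {τ : ℕ → ℝ} {τ₀ : ℝ}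
    (hτ : ∀ n, τ n ∈ Icc α β) (hτ₀ : τ₀ ∈ Icc α β) (hlim : Tendsto τ atTop (𝓝 τ₀))
    (hq : ∀ n, IsWellBottom T (q n) (G.pt e (τ n))) {γ : G.GPath}
    (hγ : γ ∈ leafPaths T (G.pt e τ₀)) (hends : γ.map 0 ≠ γ.map 1) {S : ℝ} (hS : S ∈ Ico 0 1) :
    ∀ᶠ n in atTop, AntitoneOn (q n ∘ γ.ext) (Icc 0 S) := by
  have hshort : ∀ᶠ n in atTop, |τ n - τ₀| < G.len e :=
    Metric.tendsto_nhds.1 hlim _ (G.len_pos e)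
  filter_upwards [γ.eventually_notMem_image_uIcc hends hlim hγ.2.2 hS.2, hshort] with n hn hnlen
  have hsub : uIcc (τ n) τ₀ ⊆ Icc α β := uIcc_subset_Icc (hτ n) hτ₀
  have hcompact : IsCompact (Icc 0 1 ∩ γ.ext ⁻¹' (G.pt e '' uIcc (τ n) τ₀)) :=
    isCompact_Icc.inter_right
      ((isCompact_uIcc.image (continuous_pt G e)).isClosed.preimage γ.continuous_ext)
  obtain ⟨s₀, ⟨hs₀, r₀, hr₀, hr₀s⟩, hfirst⟩ := hcompact.exists_isLeast
    ⟨1, right_mem_Icc.2 zero_le_one, τ₀, right_mem_uIcc, (hγ.2.2.symm.trans (γ.ext_coe 1).symm)⟩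
  have hSs₀ : S < s₀ := not_le.1 fun hle => hn s₀ ⟨hs₀.1, hle⟩ ⟨r₀, hr₀, hr₀s⟩
  have hseg : uIcc r₀ (τ n) ⊆ uIcc (τ n) τ₀ := uIcc_subset_uIcc hr₀ left_mem_uIcc
  have hext₀ : γ.ext 0 = γ.map 0 := γ.ext_coe 0
  refine ((hq n).antitoneOn_of_segment (hS.1.trans_lt hSs₀) γ.continuous_ext
    ((γ.injOn_ext Subset.rfl fun _ _ => hends).mono (Icc_subset_Icc_right hs₀.2))
    (fun s _ => hγ.1 (mem_range_self _)) (hext₀ ▸ hγ.2.1) hr₀s.symm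
    ((injOn_pt_uIcc (hlen (hτ n)) (hlen hτ₀) (abs_sub_comm τ₀ _ ▸ hnlen)).mono hseg)
    (hptT.mono_left (hseg.trans hsub)) fun s hs hmem => ?_).mono (Icc_subset_Icc_right hSs₀.le)
  exact hs.2.not_ge
    (hfirst ⟨⟨hs.1, hs.2.le.trans hs₀.2⟩, image_mono hseg hmem⟩)

theorem locallyRegularOn_leafPaths {q : ℕ → G.Point → ℝ} {a : G.Point}
    (hends : ∀ γ ∈ leafPaths T a, γ.map 0 ≠ γ.map 1)
    (hq : ∀ γ ∈ leafPaths T a, ∀ S ∈ Ico (0 : ℝ) 1,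
      ∀ᶠ n in atTop, AntitoneOn (q n ∘ γ.ext) (Icc 0 S)) :
    LocallyRegularOn q ((⋃ γ ∈ leafPaths T a, range γ.map) \ {a}) := by
  refine locallyRegularOn_of_curves fun x ⟨hx, hxa⟩ => ?_
  obtain ⟨γ, hγ, s, rfl⟩ := mem_iUnion₂.1 hx
  have hs : (s : ℝ) < 1 := s.2.2.lt_of_ne fun hs => hxa (by
    rw [show s = 1 from Subtype.ext hs]
    exact hγ.2.2)
  have hinj := γ.injOn_ext Subset.rfl fun _ _ => hends γ hγ
  have hsub : Icc 0 (((s : ℝ) + 1) / 2) ⊆ Icc 0 1 := Icc_subset_Icc_right (by linarith)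
  have hpos : 0 < ((s : ℝ) + 1) / 2 := by linarith [s.2.1]
  refine ⟨γ.ext, 0, (s + 1) / 2, hpos, γ.continuous_ext, hinj.mono hsub,
    ⟨s, ⟨s.2.1, by linarith⟩, γ.ext_coe s⟩, ?_, fun e s₁ s₂ c hc hsub' => hc.eventuallyRegular ?_⟩
  · rintro _ ⟨r, hr, rfl⟩
    refine ⟨mem_iUnion₂.2 ⟨γ, hγ, mem_range_self _⟩, fun hra => ?_⟩
    have hr₁ : r = 1 := hinj (hsub hr) (right_mem_Icc.2 zero_le_one)
      ((mem_singleton_iff.1 hra).trans (hγ.2.2.symm.trans (γ.ext_coe 1).symm))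
    linarith [hr.2]
  · filter_upwards [hq γ hγ ((s + 1) / 2) ⟨hpos.le, by linarith⟩] with n hn
    exact hn.mono hsub'

theorem ae_update_pt_eq [DecidableEq G.Point] (ρ : G.Point → ℝ) (x : G.Point) (y : ℝ) (e : E) :
    (fun t => Function.update ρ x y (G.pt e t)) =ᵐ[G.edgeMeasure e] fun t => ρ (G.pt e t) := by
  have hsub : {t | t ∈ Ioo 0 (G.len e) ∧ G.pt e t = x}.Subsingleton := fun s hs t ht =>
    injOn_pt e hs.1 ht.1 (hs.2.trans ht.2.symm)
  refine (ae_edgeMeasure_iff G).2 ((hsub.countable.ae_notMem volume).mono fun t ht ht' => ?_)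
  exact Function.update_of_ne (fun htx => ht ⟨ht', htx⟩) _ _

theorem update_mem_boundedClass [DecidableEq G.Point] {M : ℝ} {ρ : G.Point → ℝ}
    (hρ : ρ ∈ G.boundedClass M) (x : G.Point) {y : ℝ} (hy : y ∈ Icc 0 M) :
    Function.update ρ x y ∈ G.boundedClass M := by
  refine ⟨fun e => (hρ.1 e).congr (ae_update_pt_eq ρ x y e).symm, fun z => ?_⟩
  rw [Function.update_apply]
  split_ifs
  exacts [hy, hρ.2 z]

theorem WeakTendsto.update_right [Fintype E] [DecidableEq G.Point] {q : ℕ → G.Point → ℝ}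
    {q₀ : G.Point → ℝ} (h : WeakTendsto q q₀) (x : G.Point) (y : ℝ) :
    WeakTendsto q (Function.update q₀ x y) := by
  intro f
  have heq e : ∫ t, Function.update q₀ x y (G.pt e t) * f (G.pt e t) ∂(G.edgeMeasure e) =
      ∫ t, q₀ (G.pt e t) * f (G.pt e t) ∂(G.edgeMeasure e) :=
    integral_congr_ae ((ae_update_pt_eq q₀ x y e).mul .rfl)
  simpa only [heq] using h f

theorem isWellBottom_update [DecidableEq G.Point] {q : ℕ → G.Point → ℝ} {ρ : G.Point → ℝ}
    {a : G.Point} {y : ℝ} (hy : ∀ x, y ≤ ρ x) (hends : ∀ γ ∈ leafPaths T a, γ.map 0 ≠ γ.map 1)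
    (hq : ∀ γ ∈ leafPaths T a, ∀ S ∈ Ico (0 : ℝ) 1,
      ∀ᶠ n in atTop, AntitoneOn (q n ∘ γ.ext) (Icc 0 S)) {U : Filter ℕ} [U.NeBot]
    (hU : U ≤ atTop) (hlim : ∀ x ∈ (⋃ γ ∈ leafPaths T a, range γ.map) \ {a},
      Tendsto (fun n => q n x) U (𝓝 (ρ x))) :
    IsWellBottom T (Function.update ρ a y) a := by
  intro γ hγ s t hst
  rcases (unitInterval.le_one' (t := t)).eq_or_lt with rfl | ht
  · simp only [hγ.2.2, Function.update_self, Function.update_apply]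
    split_ifs
    exacts [le_rfl, hy _]
  have hne {r : unitInterval} (hr : r < 1) : γ.map r ≠ a := fun hra =>
    hends γ hγ ((γ.inj r 1 hr (hra.trans hγ.2.2.symm)).1 ▸ hra.trans hγ.2.2.symm)
  have hlim' {r : unitInterval} (hr : r < 1) :
      Tendsto (fun n => q n (γ.map r)) U (𝓝 (ρ (γ.map r))) :=
    hlim _ ⟨mem_iUnion₂.2 ⟨γ, hγ, mem_range_self r⟩, hne hr⟩
  have hs := hst.trans_lt ht
  simp only [Function.update_of_ne (hne hs), Function.update_of_ne (hne ht)]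
  refine le_of_tendsto_of_tendsto (hlim' ht) (hlim' hs) (hU ?_)
  filter_upwards [hq γ hγ t ⟨t.2.1, ht⟩] with n hn
  simpa only [Function.comp_apply, GPath.ext_coe] using
    hn ⟨s.2.1, hst⟩ ⟨t.2.1, le_rfl⟩ (Subtype.coe_le_coe.2 hst)

theorem exists_subseq_weakTendsto_singleWellClass [Fintype E] (hT : G.IsSubgraph T)
    (hacyclic : ∀ γ : G.GPath, range γ.map ⊆ T → γ.map 0 ≠ γ.map 1) {M : ℝ} (hM : 0 ≤ M)
    {q : ℕ → G.Point → ℝ} (hq : ∀ n, q n ∈ G.singleWellClass T M) :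
    ∃ (φ : ℕ → ℕ) (q₀ : G.Point → ℝ), StrictMono φ ∧ q₀ ∈ G.singleWellClass T M ∧
      WeakTendsto (fun n => q (φ n)) q₀ := by
  classical
  choose a haT ha using fun n => (hq n).2
  obtain ⟨e, α, β, ψ, τ, τ₀, hlen, hptT, hψ, hτ, hτa, hτ₀, hτlim⟩ := hT.exists_subseq haT
  have hbottom n : IsWellBottom T (q (ψ n)) (G.pt e (τ n)) := fun γ hγ =>
    ha (ψ n) γ hγ.1 hγ.2.1 (hγ.2.2.trans (hτa n).symm)
  have hends : ∀ γ ∈ leafPaths T (G.pt e τ₀), γ.map 0 ≠ γ.map 1 := fun γ hγ => hacyclic γ hγ.1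
  have hanti : ∀ γ ∈ leafPaths T (G.pt e τ₀), ∀ S ∈ Ico (0 : ℝ) 1,
      ∀ᶠ n in atTop, AntitoneOn (q (ψ n) ∘ γ.ext) (Icc 0 S) := fun γ hγ S hS =>
    eventually_antitoneOn_ext hlen hptT hτ hτ₀ hτlim hbottom hγ (hends γ hγ) hS
  obtain ⟨φ, U, q₀, hφ, hU, hq₀, hweak, hlim⟩ :=
    (locallyRegularOn_leafPaths hends hanti).exists_subseq_weakTendsto hM fun n => (hq (ψ n)).1
  -- The potentials need not converge at the limiting bottom, so the limit is reset there to the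
  -- lower bound `0`.
  have hwell : IsWellBottom T (Function.update q₀ (G.pt e τ₀) 0) (G.pt e τ₀) :=
    isWellBottom_update (fun x => (hq₀.2 x).1) hends
      (fun γ hγ S hS => hφ.tendsto_atTop.eventually (hanti γ hγ S hS)) hU hlim
  exact ⟨ψ ∘ φ, Function.update q₀ (G.pt e τ₀) 0, hψ.comp hφ,
    ⟨update_mem_boundedClass hq₀ _ ⟨le_rfl, hM⟩, G.pt e τ₀, hptT hτ₀,
      fun γ hγT hγ₀ hγ₁ => hwell γ ⟨hγT, hγ₀, hγ₁⟩⟩, hweak.update_right _ 0⟩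

end MetricGraph

/-! ### Extremal gaps -/

namespace MetricGraph

variable {E : Type*} {G : MetricGraph E}

theorem exists_isMinOn_isMaxOn_gap [Fintype E] [Nonempty E] {M : ℝ} {Λ : Set (G.Point → ℝ)}
    (hΛ : Λ ⊆ G.boundedClass M) (hne : Λ.Nonempty)
    (hlim : ∀ q : ℕ → G.Point → ℝ, (∀ n, q n ∈ Λ) → ∃ (φ : ℕ → ℕ) (q₀ : G.Point → ℝ),
      StrictMono φ ∧ q₀ ∈ Λ ∧ WeakTendsto (fun n => q (φ n)) q₀) :
    (∃ q ∈ Λ, IsMinOn G.gap Λ q) ∧ (∃ q ∈ Λ, IsMaxOn G.gap Λ q) := by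
  have hcomp : IsCompact (G.gap '' Λ) := by
    refine IsSeqCompact.isCompact fun x hx => ?_
    choose q hq hqx using hx
    obtain ⟨φ, q₀, hφ, hq₀, hweak⟩ := hlim q hq
    have hgap := hweak.tendsto_gap
      (fun n => isBoundedPotential_of_mem_boundedClass (hΛ (hq (φ n))))
      (isBoundedPotential_of_mem_boundedClass (hΛ hq₀))
      (fun n => abs_le_of_mem_boundedClass (hΛ (hq (φ n)))) (abs_le_of_mem_boundedClass (hΛ hq₀))
    exact ⟨_, mem_image_of_mem _ hq₀, φ, hφ, hgap.congr fun n => hqx (φ n)⟩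
  obtain ⟨_, ⟨q, hq, rfl⟩, hmin⟩ := hcomp.exists_isLeast (hne.image _)
  obtain ⟨_, ⟨q', hq', rfl⟩, hmax⟩ := hcomp.exists_isGreatest (hne.image _)
  exact ⟨⟨q, hq, fun p hp => hmin (mem_image_of_mem _ hp)⟩,
    ⟨q', hq', fun p hp => hmax (mem_image_of_mem _ hp)⟩⟩

theorem zero_mem_boundedClass {M : ℝ} (hM : 0 ≤ M) : (fun _ => 0) ∈ G.boundedClass M :=
  ⟨fun _ => aestronglyMeasurable_const, fun _ => ⟨le_rfl, hM⟩⟩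

theorem zero_mem_convexClass [Fintype E] (P : Set G.GPath) {M : ℝ} (hM : 0 ≤ M) :
    (fun _ => 0) ∈ G.convexClass P M :=
  ⟨zero_mem_boundedClass hM, fun γ _ r s t _ _ => by simp⟩

theorem zero_mem_singleWellClass {T : Set G.Point} (hT : T.Nonempty) {M : ℝ} (hM : 0 ≤ M) :
    (fun _ => 0) ∈ G.singleWellClass T M :=
  ⟨zero_mem_boundedClass hM, hT.some, hT.some_mem, fun _ _ _ _ => antitone_const⟩

theorem nonempty_edge_of_nonempty_point (G : MetricGraph E) [Nonempty G.Point] : Nonempty E :=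
  let ⟨e, _⟩ := G.exists_pt_eq (Classical.arbitrary G.Point)
  ⟨e⟩

end MetricGraph

open MetricGraph in
theorem mainTheorem1_general {E : Type*} [Fintype E] [Nonempty E] (G : MetricGraph E)
    (P : Set G.GPath) {T : Set G.Point} (hT : G.IsSubgraph T) (hTne : T.Nonempty)
    (hacyclic : ∀ γ : G.GPath, range γ.map ⊆ T → γ.map 0 ≠ γ.map 1) {M : ℝ} (hM : 0 ≤ M)
    {Λ : Set (G.Point → ℝ)} (hΛ : Λ = G.convexClass P M ∨ Λ = G.singleWellClass T M) :
    (∀ q ∈ Λ, IsLeast (G.atLeastEigenvalues q 1) (G.eigenvalue q 1) ∧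
      IsLeast (G.atLeastEigenvalues q 2) (G.eigenvalue q 2)) ∧
    (∃ q ∈ Λ, IsMinOn G.gap Λ q) ∧ (∃ q ∈ Λ, IsMaxOn G.gap Λ q) := by
  have hsub : Λ ⊆ G.boundedClass M := by
    rcases hΛ with rfl | rfl <;> exact fun q hq => hq.1
  refine ⟨fun q hq => ?_, ?_⟩
  · have hbdd := isBoundedPotential_of_mem_boundedClass (hsub hq)
    exact ⟨isLeast_eigenvalue hbdd 0, isLeast_eigenvalue hbdd 1⟩
  · rcases hΛ with rfl | rfl
    · exact exists_isMinOn_isMaxOn_gap hsub ⟨_, zero_mem_convexClass P hM⟩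
        fun q hq => exists_subseq_weakTendsto_convexClass hM hq
    · exact exists_isMinOn_isMaxOn_gap hsub ⟨_, zero_mem_singleWellClass hTne hM⟩
        fun q hq => exists_subseq_weakTendsto_singleWellClass hT hacyclic hM hq

theorem mainTheorem1 {E : Type*} [Fintype E] (G : MetricGraph E) [ConnectedSpace G.Point]
    (P : Set G.GPath) (hP : P.Finite) (T : Set G.Point) (hT : G.IsTree T)
    (M : ℝ) (hM : 0 < M) (Λ : Set (G.Point → ℝ))
    (hΛ : Λ = G.convexClass P M ∨ Λ = G.singleWellClass T M) :
    -- the eigenvalues `λ₁(q)` and `λ₂(q)` exist, so that `Γ[q]` is meaningful on `Λ`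
    (∀ q ∈ Λ, IsLeast (G.atLeastEigenvalues q 1) (G.eigenvalue q 1) ∧
      IsLeast (G.atLeastEigenvalues q 2) (G.eigenvalue q 2)) ∧
    (∃ q ∈ Λ, IsMinOn G.gap Λ q) ∧ (∃ q ∈ Λ, IsMaxOn G.gap Λ q) := by
  have : Nonempty E := G.nonempty_edge_of_nonempty_point
  exact mainTheorem1_general G P hT.subgraph hT.connected.nonempty hT.acyclic hM.le hΛ
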